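/- Let $d \in \mathbb N$, let $\mathcal X \subset \mathbb R^d$ be closed and convex, and let $f, g : \mathbb R^d \to \mathbb R$ be locally Lipschitz. Write $$\partial f(x) = \overline{\mathrm{conv}}\,\{ v : \text{there is } u_i \to x \text{ with } f \text{ differentiable at each } u_i \text{ and } \nabla f(u_i) \to v \}$$ for the set of Clarke subgradients (and similarly $\partial g$), $\mathcal N_{\mathcal X}(x) = \{ v : \langle v, y - x\rangle \le 0 \ \ \forall y \in \mathcal X\}$ for the normal cone, and, for $\gamma > 0$, $$\mathrm{prox}^{\gamma}_{g,\mathcal X}(x) = \operatorname*{arg\,min}_{y \in \mathcal X} \Big\{ g(y) + \frac{1}{2\gamma} \|y - x\|^2 \Big\}.$$ Let $(\Omega, \Xi, \mathbb P)$ be a probability space with a filtration $(\mathcal F_n)_{n \in \mathbb N}$, let $(\eta_n)$ be an $\mathbb R^d$-valued martingale difference sequence adapted to $(\mathcal F_n)$ (each $\eta_n$ is integrable and $\mathcal F_n$-measurable, and $\mathbb E[\eta_{n+1} | \mathcal F_n] = 0$), and let $(x_n)$ be $\mathbb R^d$-valued with $x_n$ $\mathcal F_n$-measurable. Let $(\gamma_n)_{n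 \in \mathbb N}$ be positive step sizes with $\sum_{i} \gamma_i = +\infty$, and suppose that, almost surely, for every $n$, $$x_{n+1} \in \mathrm{prox}^{\gamma_n}_{g,\mathcal X}(x_n - \gamma_n v_n + \gamma_n \eta_{n+1}) \quad\text{with}\quad v_n \in \partial f(x_n).$$ Suppose that $\sup_n \|x_n\| < +\infty$ almost surely, and that there is a real $q \ge 2$ such that $\sum_i \gamma_i^{1 + q/2} < +\infty$ and, for every compact $K \subset \mathbb R^d$, almost surely $$\sup_{n} \mathbb E\big[\|\eta_{n+1}\|^q \mathbf 1_{x_n \in K} \,\big|\, \mathcal F_n\big] < +\infty .$$ Let $\tau_n = \sum_{i=1}^n \gamma_i$ and define the interpolated process $\mathsf X \in \mathcal C(\mathbb R_+, \mathbb R^d)$ by $$\mathsf X(t) = x_n + \frac{t - \tau_n}{\gamma_{n+1}} (x_{n+1} - x_n) \qquad \text{for } \tau_n \le t < \tau_{n+1}.$$ Endow $\mathcal C(\mathbb R_+, \mathbb R^d)$ with the topology of uniform convergence on compact intervals. Then, almost surely: 1. the family $(\mathsf X(t + \cdot))_{t \ge 0}$ is relatively compact in $\mathcal C(\mathbb R_+,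 \mathbb R^d)$; 2. whenever $t_n \to +\infty$ in $\mathbb R_+$ and $\mathsf x \in \mathcal C(\mathbb R_+, \mathbb R^d)$ are such that $\mathsf X(t_n + \cdot) \to \mathsf x$ in $\mathcal C(\mathbb R_+, \mathbb R^d)$, the curve $\mathsf x$ is a solution of the differential inclusion $$\dot{\mathsf x}(t) \in - \partial f(\mathsf x(t)) - \partial g(\mathsf x(t)) - \mathcal N_{\mathcal X}(\mathsf x(t)),$$ that is, $\mathsf x$ is absolutely continuous on every $[0, T]$ and satisfies the inclusion for almost every $t \ge 0$. -/

import Mathlib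

open Filter Topology MeasureTheory ProbabilityTheory
open scoped NNReal ENNReal Pointwise

namespace SPGD

section Deterministic

variable {E : Type*} [NormedAddCommGroup E] [InnerProductSpace ℝ E]

/-- The set of Clarke subgradients of `f` at `x`: the closed convex hull of all limits of
gradients of `f` along sequences of differentiability points converging to `x`. -/
noncomputable def clarkeSubdifferential [CompleteSpace E] (f : E → ℝ) (x : E) : Set E :=
  closedConvexHull ℝ
    {v : E | ∃ u : ℕ → E, Tendsto u atTop (𝓝 x) ∧ (∀ i, DifferentiableAt ℝ f (u i)) ∧
      Tendsto (fun i => gradient f (u i)) atTop (𝓝 v)}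

/-- The normal cone `{v : ⟪v, y - x⟫ ≤ 0 for all y ∈ C}`. -/
def normalCone (C : Set E) (x : E) : Set E :=
  {v : E | ∀ y ∈ C, inner ℝ v (y - x) ≤ 0}

/-- The proximal operator of `g` on `C` with step `γ`:
the set of minimizers over `y ∈ C` of `g y + ‖y - x‖ ^ 2 / (2 γ)`. -/
def prox (g : E → ℝ) (C : Set E) (γ : ℝ) (x : E) : Set E :=
  {y : E | y ∈ C ∧ IsMinOn (fun z => g z + 1 / (2 * γ) * ‖z - x‖ ^ 2) C y}

/-- The set-valued map `x ↦ - ∂f(x) - ∂g(x) - N_C(x)` (Minkowski operations on sets). -/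
noncomputable def drift [CompleteSpace E] (f g : E → ℝ) (C : Set E) (x : E) : Set E :=
  -clarkeSubdifferential f x - clarkeSubdifferential g x - normalCone C x

/-- `x : ℝ₊ → E` is a solution of the differential inclusion `x' ∈ H(x)`: it is absolutely
continuous on every interval `[0, T]` and, for almost every `t > 0`, it is differentiable at `t`
with derivative in `H (x t)`. The curve is read as a function of a real variable through
`Real.toNNReal`, which does not affect its derivative at any `t > 0`. -/
def IsSolution (H : E → Set E) (x : ℝ≥0 → E) : Prop :=
  (∀ T : ℝ, 0 ≤ T → AbsolutelyContinuousOnInterval (fun t : ℝ => x t.toNNReal) 0 T) ∧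
  ∀ᵐ t : ℝ ∂(volume.restrict (Set.Ioi 0)),
    ∃ w ∈ H (x t.toNNReal), HasDerivAt (fun s : ℝ => x s.toNNReal) w t

/-- The discrete time `τ n = γ 1 + ⋯ + γ n`. -/
def tau (γ : ℕ → ℝ) (n : ℕ) : ℝ := ∑ i ∈ Finset.Icc 1 n, γ i

/-- The last index `n` with `τ n ≤ t`. -/
noncomputable def timeIndex (γ : ℕ → ℝ) (t : ℝ) : ℕ := sSup {n : ℕ | tau γ n ≤ t}

/-- Linear interpolation of the points `x n` placed at the times `τ n`. -/
noncomputable def interpolation (γ : ℕ → ℝ) (x : ℕ → E) (t : ℝ) : E :=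
  x (timeIndex γ t) +
    ((t - tau γ (timeIndex γ t)) / γ (timeIndex γ t + 1)) •
      (x (timeIndex γ t + 1) - x (timeIndex γ t))

theorem tau_succ (γ : ℕ → ℝ) (n : ℕ) : tau γ (n + 1) = tau γ n + γ (n + 1) := by
  unfold tau
  rw [Finset.sum_Icc_succ_top (by omega)]

theorem tau_strictMono {γ : ℕ → ℝ} (hγ : ∀ n, 0 < γ n) : StrictMono (tau γ) :=
  strictMono_nat_of_lt_succ fun n => by rw [tau_succ]; linarith [hγ (n + 1)]

theorem tendsto_tau {γ : ℕ → ℝ}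
    (hdiv : Tendsto (fun n => ∑ i ∈ Finset.range n, γ i) atTop atTop) :
    Tendsto (tau γ) atTop atTop := by
  have h : ∀ n, tau γ n = (∑ i ∈ Finset.range (n + 1), γ i) + (-γ 0) := by
    intro n
    induction n with
    | zero => simp [tau]
    | succ k ih => rw [tau_succ, ih, Finset.sum_range_succ _ (k + 1)]; ring
  rw [funext h]
  exact tendsto_atTop_add_const_right _ _ ((tendsto_add_atTop_iff_nat 1).2 hdiv)

/-- On `[τ n, τ (n + 1))` the interpolation is given by the usual affine formula. -/
theorem interpolation_eq {γ : ℕ → ℝ} (hγ : ∀ n, 0 < γ n) (x : ℕ → E) {n : ℕ} {t : ℝ}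
    (h₁ : tau γ n ≤ t) (h₂ : t < tau γ (n + 1)) :
    interpolation γ x t = x n + ((t - tau γ n) / γ (n + 1)) • (x (n + 1) - x n) := by
  have hn : timeIndex γ t = n := by
    refine IsGreatest.csSup_eq ⟨h₁, fun m hm => ?_⟩
    have : tau γ m < tau γ (n + 1) := lt_of_le_of_lt hm h₂
    exact Nat.lt_succ_iff.1 ((tau_strictMono hγ).lt_iff_lt.1 this)
  rw [interpolation, hn]

theorem continuousOn_interpolation {γ : ℕ → ℝ} (hγ : ∀ n, 0 < γ n) (x : ℕ → E) (n : ℕ) :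
    ContinuousOn (interpolation γ x) (Set.Icc 0 (tau γ n)) := by
  induction n with
  | zero => simp [tau]
  | succ n ih =>
    have h0 : 0 ≤ tau γ n := by
      have := (tau_strictMono hγ).monotone (Nat.zero_le n)
      simpa [tau] using this
    have h1 : tau γ n ≤ tau γ (n + 1) := (tau_strictMono hγ).monotone (Nat.le_succ n)
    rw [← Set.Icc_union_Icc_eq_Icc h0 h1]
    refine ih.union_of_isClosed ?_ isClosed_Icc isClosed_Icc
    have hc : ContinuousOn
        (fun t : ℝ => x n + ((t - tau γ n) / γ (n + 1)) • (x (n + 1) - x n))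
        (Set.Icc (tau γ n) (tau γ (n + 1))) := by fun_prop
    refine hc.congr fun t ht => ?_
    rcases ht.2.lt_or_eq with h | h
    · exact interpolation_eq hγ x ht.1 h
    · subst h
      rw [interpolation_eq hγ x le_rfl (tau_strictMono hγ (Nat.lt_succ_self (n + 1)))]
      have hne : γ (n + 1) ≠ 0 := (hγ _).ne'
      simp [tau_succ, hne]

/-- The linearly interpolated process as an element of `C(ℝ₊, E)`; on `[τ n, τ (n + 1))` it equals
`x n + ((t - τ n) / γ (n + 1)) • (x (n + 1) - x n)`. -/
noncomputable def interpolatedProcess (γ : ℕ → ℝ) (hγ : ∀ n, 0 < γ n)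
    (hdiv : Tendsto (fun n => ∑ i ∈ Finset.range n, γ i) atTop atTop) (x : ℕ → E) :
    C(ℝ≥0, E) where
  toFun t := interpolation γ x t
  continuous_toFun := by
    rw [continuous_iff_continuousAt]
    intro t
    obtain ⟨n, hn⟩ := ((tendsto_tau hdiv).eventually_gt_atTop (t : ℝ)).exists
    have hmap : Tendsto (fun s : ℝ≥0 => (s : ℝ)) (𝓝 t)
        (𝓝[Set.Icc 0 (tau γ n)] (t : ℝ)) := by
      refine tendsto_nhdsWithin_iff.2 ⟨NNReal.continuous_coe.continuousAt, ?_⟩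
      filter_upwards [NNReal.continuous_coe.continuousAt.eventually (gt_mem_nhds hn)] with s hs
      exact ⟨s.2, hs.le⟩
    exact (continuousOn_interpolation hγ x n t ⟨t.2, hn.le⟩).tendsto.comp hmap

/-- The shifted curve `X (t + ·)`. -/
def shift (X : C(ℝ≥0, E)) (t : ℝ≥0) : C(ℝ≥0, E) where
  toFun s := X (t + s)
  continuous_toFun := X.continuous.comp (continuous_const.add continuous_id)

end Deterministic

/-- `η` is a martingale difference sequence for the filtration `ℱ`: it is adapted, integrable and
`𝔼[η (n + 1) | ℱ n] = 0` almost surely. -/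
def IsMartingaleDifference {Ω E : Type*} [NormedAddCommGroup E] [NormedSpace ℝ E]
    [CompleteSpace E] {m0 : MeasurableSpace Ω} (ℱ : Filtration ℕ m0) (P : Measure Ω)
    (η : ℕ → Ω → E) : Prop :=
  StronglyAdapted ℱ η ∧ (∀ n, Integrable (η n) P) ∧ ∀ n, P[η (n + 1) | ℱ n] =ᵐ[P] 0

end SPGD

/-! The main obstacle is the normal cone: its elements are unbounded, so the increments of the
scheme cannot be estimated term by term. The proof never isolates a normal vector along the
iterates. Optimality of the proximal step (`exists_clarkeSubgradient_of_mem_prox`) gives `w n ∈ ∂g(x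
(n + 1))` with `⟪x (n + 1) - x n + γ n • (v n + w n) - γ n • η (n + 1), x (n + 1) - z⟫ ≤ 0` for all
`z ∈ C`. Completing a square turns this into an inequality for `‖x n - z‖ ^ 2 / 2`, whose errors are
increments of the sums of `γ η`, `γ ⟪η, x⟫` and `γ² ‖η‖²`.

Deterministic half (`IsApproximatePath`): suppose these errors vanish on late windows of bounded
length. Testing with `z = x n` bounds displacements by `2 L` times the window length plus a
vanishing error, which gives compactness by Arzelà–Ascoli and Lipschitz limit curves `Y`. On a short
window the drifts are averaged, the limit is taken with `z` fixed, and the result is divided by the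
length of the window. Upper semicontinuity and compactness of Clarke subdifferentials yield `u ∈
∂f(Y s)` and `w ∈ ∂g(Y s)` with `-(Y' s + u + w)` normal to `C`.

Probabilistic half: for a real martingale difference `ζ`, the average `Z (n + 1) = (Z n + γ n ζ n) /
(1 + γ n)` tends to zero by a Robbins–Siegmund argument applied to `|Z| ^ q`
(`ae_tendsto_zero_of_le_contraction`), and `Z → 0` makes the window sums of `γ ζ` vanish. The almost
sure conditional moment bounds are made uniform by restricting the noise to predictable events, over
countably many levels. -/

namespace SPGD

/-! ### Clarke subdifferentials: mean value inequality, compactness, upper semicontinuity -/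

section Clarke

variable {E : Type*} [NormedAddCommGroup E] [InnerProductSpace ℝ E]

theorem inner_gradient_eq_fderiv [CompleteSpace E] (f : E → ℝ) (u h : E) :
    inner ℝ (gradient f u) h = fderiv ℝ f u h := by
  simp [gradient]

theorem norm_gradient_eq_norm_fderiv [CompleteSpace E] (f : E → ℝ) (u : E) :
    ‖gradient f u‖ = ‖fderiv ℝ f u‖ := by
  simp [gradient]

/-- The given segment may consist of non-differentiability points only. By Rademacher and Fubini,
almost every parallel translate of it meets the differentiability set at almost every parameter; the
derivative is integrated there, and continuity recovers the given segment. -/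
theorem _root_.LipschitzWith.sub_le_of_inner_gradient_le [FiniteDimensional ℝ E]
    {f : E → ℝ} {K : ℝ≥0} (hf : LipschitzWith K f) {U : Set E} (hU : IsOpen U) (hUc : Convex ℝ U)
    {h : E} {a : ℝ} (ha : ∀ u ∈ U, DifferentiableAt ℝ f u → inner ℝ (gradient f u) h ≤ a)
    {x : E} (hx : x ∈ U) (hxh : x + h ∈ U) : f (x + h) - f x ≤ a := by
  borelize E
  let μ : Measure E := (stdOrthonormalBasis ℝ E).toBasis.addHaar
  have h1 : ∀ᵐ p ∂μ, ∀ᵐ r : ℝ, DifferentiableAt ℝ f (p + r • h) := by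
    have hm : MeasurableSet {z : E × ℝ | DifferentiableAt ℝ f (z.1 + z.2 • h)} :=
      (measurableSet_of_differentiableAt ℝ f).preimage (f := fun z : E × ℝ => z.1 + z.2 • h)
        (by fun_prop)
    rw [Measure.ae_ae_comm hm]
    refine Eventually.of_forall fun r => ?_
    exact (measurePreserving_add_right μ (r • h)).quasiMeasurePreserving.ae
      hf.ae_differentiableAt
  have h2 : ∀ᵐ p ∂μ, p ∈ U → p + h ∈ U → f (p + h) - f p ≤ a := by
    filter_upwards [h1] with p hp hpU hphU
    let φ : ℝ → ℝ := fun r => f (p + r • h)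
    have hline : LipschitzWith ‖h‖₊ (fun r : ℝ => p + r • h) := by
      refine LipschitzWith.of_dist_le_mul fun r s => ?_
      rw [dist_add_left, dist_eq_norm, ← sub_smul, norm_smul, mul_comm]
      rfl
    have hφ : AbsolutelyContinuousOnInterval φ 0 1 :=
      (hf.comp hline).lipschitzOnWith.absolutelyContinuousOnInterval
    have hd : ∀ᵐ r : ℝ, r ∈ Set.Icc (0 : ℝ) 1 → deriv φ r ≤ a := by
      filter_upwards [hp] with r hr hr01
      have hmem : p + r • h ∈ U := hUc.add_smul_mem hpU hphU hr01
      have hd1 : HasDerivAt (fun s : ℝ => p + s • h) h r := by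
        simpa using ((hasDerivAt_id r).smul_const h).const_add p
      have hd2 : HasDerivAt φ (fderiv ℝ f (p + r • h) h) r :=
        hr.hasFDerivAt.comp_hasDerivAt r hd1
      rw [hd2.deriv, ← inner_gradient_eq_fderiv]
      exact ha _ hmem hr
    have hint : ∫ r in (0 : ℝ)..1, deriv φ r = φ 1 - φ 0 := hφ.integral_deriv_eq_sub
    have hle : ∫ r in (0 : ℝ)..1, deriv φ r ≤ ∫ _ in (0 : ℝ)..1, a := by
      refine intervalIntegral.integral_mono_ae_restrict zero_le_one
        hφ.intervalIntegrable_deriv (by simp) ?_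
      exact (ae_restrict_iff' measurableSet_Icc).2 hd
    simpa [hint, φ] using hle
  by_contra! hlt
  -- A strict violation at `x` would persist on an open set of base points, which must meet the
  -- dense set of good ones.
  have hopen : IsOpen (U ∩ ((fun p => p + h) ⁻¹' U ∩ {p | a < f (p + h) - f p})) := by
    have := hf.continuous
    exact hU.inter ((hU.preimage (by fun_prop)).inter
      (isOpen_lt continuous_const (by fun_prop)))
  obtain ⟨p, hp, hp'⟩ := (Measure.dense_of_ae h2).inter_open_nonempty _ hopen ⟨x, hx, hxh, hlt⟩
  exact (hp' hp.1 hp.2.1).not_gt hp.2.2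

theorem _root_.LipschitzOnWith.sub_le_of_inner_gradient_le [FiniteDimensional ℝ E]
    {f : E → ℝ} {K : ℝ≥0} {U : Set E} (hf : LipschitzOnWith K f U) (hU : IsOpen U)
    (hUc : Convex ℝ U) {h : E} {a : ℝ}
    (ha : ∀ u ∈ U, DifferentiableAt ℝ f u → inner ℝ (gradient f u) h ≤ a)
    {x : E} (hx : x ∈ U) (hxh : x + h ∈ U) : f (x + h) - f x ≤ a := by
  obtain ⟨F, hF, hfF⟩ := hf.extend_real
  rw [hfF hx, hfF hxh]
  refine hF.sub_le_of_inner_gradient_le hU hUc (fun u hu hd => ?_) hx hxh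
  have he : f =ᶠ[𝓝 u] F := Filter.eventuallyEq_of_mem (hU.mem_nhds hu) hfF
  have := ha u hu (he.differentiableAt_iff.2 hd)
  rwa [inner_gradient_eq_fderiv, he.fderiv_eq, ← inner_gradient_eq_fderiv] at this

theorem convex_clarkeSubdifferential [CompleteSpace E] (f : E → ℝ) (x : E) :
    Convex ℝ (clarkeSubdifferential f x) := convex_closedConvexHull

theorem isClosed_clarkeSubdifferential [CompleteSpace E] (f : E → ℝ) (x : E) :
    IsClosed (clarkeSubdifferential f x) := isClosed_closedConvexHull

/-- A closed convex set absorbs both the limits and the closed convex hull in the definition, so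
bounds on Clarke subgradients reduce to bounds on nearby gradients. -/
theorem clarkeSubdifferential_subset_of_gradient_mem [CompleteSpace E] {f : E → ℝ} {U S : Set E}
    (hU : IsOpen U) (hS : IsClosed S) (hSc : Convex ℝ S)
    (h : ∀ u ∈ U, DifferentiableAt ℝ f u → gradient f u ∈ S) {x : E} (hx : x ∈ U) :
    clarkeSubdifferential f x ⊆ S := by
  refine closedConvexHull_min ?_ hSc hS
  rintro v ⟨u, hu, hd, hv⟩
  refine hS.mem_of_tendsto hv ?_
  filter_upwards [hu.eventually (hU.mem_nhds hx)] with i hi using h _ hi (hd i)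

theorem _root_.LocallyLipschitz.exists_ball_gradient_bound [CompleteSpace E] {f : E → ℝ}
    (hf : LocallyLipschitz f) (x : E) :
    ∃ δ > 0, ∃ K : ℝ≥0, LipschitzOnWith K f (Metric.ball x δ) ∧
      ∀ u ∈ Metric.ball x δ, ‖gradient f u‖ ≤ K := by
  obtain ⟨K, t, ht, hK⟩ := hf x
  obtain ⟨δ, hδ, hball⟩ := Metric.mem_nhds_iff.1 ht
  refine ⟨δ, hδ, K, hK.mono hball, fun u hu => ?_⟩
  rw [norm_gradient_eq_norm_fderiv]
  exact norm_fderiv_le_of_lipschitzOn ℝ (Metric.isOpen_ball.mem_nhds hu) (hK.mono hball)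

theorem _root_.LocallyLipschitz.isCompact_clarkeSubdifferential [FiniteDimensional ℝ E] {f : E → ℝ}
    (hf : LocallyLipschitz f) (x : E) : IsCompact (clarkeSubdifferential f x) := by
  obtain ⟨δ, hδ, K, -, hK⟩ := hf.exists_ball_gradient_bound x
  refine (isCompact_closedBall (0 : E) K).of_isClosed_subset (isClosed_clarkeSubdifferential f x) ?_
  refine clarkeSubdifferential_subset_of_gradient_mem Metric.isOpen_ball Metric.isClosed_closedBall
    (convex_closedBall _ _) (fun u hu _ => ?_) (Metric.mem_ball_self hδ)
  simpa using hK u hu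

theorem _root_.LocallyLipschitz.exists_clarkeSubdifferential_bound [CompleteSpace E] {f : E → ℝ}
    (hf : LocallyLipschitz f) {S : Set E} (hS : IsCompact S) :
    ∃ L : ℝ, 0 ≤ L ∧ ∀ x ∈ S, ∀ v ∈ clarkeSubdifferential f x, ‖v‖ ≤ L := by
  refine hS.induction_on (p := fun S => ∃ L : ℝ, 0 ≤ L ∧ ∀ x ∈ S,
    ∀ v ∈ clarkeSubdifferential f x, ‖v‖ ≤ L) ⟨0, le_rfl, by simp⟩ ?_ ?_ ?_
  · rintro s t hst ⟨L, hL, h⟩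
    exact ⟨L, hL, fun x hx => h x (hst hx)⟩
  · rintro s t ⟨L, hL, h⟩ ⟨L', hL', h'⟩
    refine ⟨max L L', le_max_of_le_left hL, fun x hx v hv => ?_⟩
    rcases hx with hx | hx
    · exact (h x hx v hv).trans (le_max_left _ _)
    · exact (h' x hx v hv).trans (le_max_right _ _)
  · intro x _
    obtain ⟨δ, hδ, K, -, hK⟩ := hf.exists_ball_gradient_bound x
    refine ⟨_, mem_nhdsWithin_of_mem_nhds (Metric.ball_mem_nhds x hδ), K, K.2, fun y hy v hv => ?_⟩
    have := clarkeSubdifferential_subset_of_gradient_mem (f := f) Metric.isOpen_ball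
      Metric.isClosed_closedBall (convex_closedBall (0 : E) K)
      (fun u hu _ => by simpa using hK u hu) hy hv
    simpa using this

/-- Gradients at points close to `x` are close to the Clarke subdifferential at `x`. -/
theorem _root_.LocallyLipschitz.exists_ball_gradient_mem_cthickening [FiniteDimensional ℝ E]
    {f : E → ℝ} (hf : LocallyLipschitz f) (x : E) {ε : ℝ} (hε : 0 < ε) :
    ∃ δ > 0, ∀ u ∈ Metric.ball x δ, DifferentiableAt ℝ f u →
      gradient f u ∈ Metric.cthickening ε (clarkeSubdifferential f x) := by
  by_contra! hcon
  obtain ⟨δ, hδ, K, -, hK⟩ := hf.exists_ball_gradient_bound x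
  -- Bad points converging to `x` have bounded gradients; any limit of these gradients is a Clarke
  -- subgradient at `x` by definition, so the gradients cannot stay `ε`-far.
  choose u hu hd hn using fun i : ℕ =>
    hcon (min δ (1 / ((i : ℝ) + 1))) (lt_min hδ (by positivity))
  have hbd : ∀ i, gradient f (u i) ∈ Metric.closedBall (0 : E) K := fun i => by
    simpa using hK _ (Metric.ball_subset_ball (min_le_left _ _) (hu i))
  obtain ⟨v, -, φ, hφ, hv⟩ := (isCompact_closedBall (0 : E) K).tendsto_subseq hbd
  have hux : Tendsto u atTop (𝓝 x) := by
    rw [tendsto_iff_dist_tendsto_zero]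
    refine squeeze_zero (fun _ => dist_nonneg) (fun i => ?_)
      tendsto_one_div_add_atTop_nhds_zero_nat
    exact (Metric.mem_ball.1 (hu i)).le.trans (min_le_right _ _)
  have hmem : v ∈ clarkeSubdifferential f x :=
    subset_closedConvexHull ⟨u ∘ φ, hux.comp hφ.tendsto_atTop, fun i => hd _, hv⟩
  obtain ⟨i, hi⟩ := (hv.eventually (Metric.ball_mem_nhds v hε)).exists
  exact hn (φ i) (Metric.mem_cthickening_of_dist_le _ v ε _ hmem (Metric.mem_ball.1 hi).le)

/-- The Clarke subdifferential is upper semicontinuous. -/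
theorem _root_.LocallyLipschitz.exists_ball_clarkeSubdifferential_subset [FiniteDimensional ℝ E]
    {f : E → ℝ} (hf : LocallyLipschitz f) (x : E) {ε : ℝ} (hε : 0 < ε) :
    ∃ δ > 0, ∀ u ∈ Metric.ball x δ,
      clarkeSubdifferential f u ⊆ Metric.cthickening ε (clarkeSubdifferential f x) := by
  obtain ⟨δ, hδ, h⟩ := hf.exists_ball_gradient_mem_cthickening x hε
  exact ⟨δ, hδ, fun u hu => clarkeSubdifferential_subset_of_gradient_mem Metric.isOpen_ball
    Metric.isClosed_cthickening ((convex_clarkeSubdifferential f x).cthickening ε) h hu⟩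

/-- If all Clarke subgradients of `f` at `x` have inner product at most `a` with `h`, then the
one-sided upper directional derivative of `f` at `x` along `h` is at most `a`. -/
theorem _root_.LocallyLipschitz.eventually_sub_le_of_inner_le [FiniteDimensional ℝ E]
    {f : E → ℝ} (hf : LocallyLipschitz f) {x h : E} {a : ℝ}
    (ha : ∀ w ∈ clarkeSubdifferential f x, inner ℝ w h ≤ a) {ε : ℝ} (hε : 0 < ε) :
    ∀ᶠ s in 𝓝[>] (0 : ℝ), f (x + s • h) - f x ≤ s * (a + ε) := by
  obtain ⟨δ₁, hδ₁, K, hK, -⟩ := hf.exists_ball_gradient_bound x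
  -- With this tolerance, replacing a gradient by a nearby subgradient changes its inner product
  -- with `h` by at most `ε`.
  have hε' : 0 < ε / (‖h‖ + 1) := by positivity
  obtain ⟨δ₂, hδ₂, hgrad⟩ := hf.exists_ball_gradient_mem_cthickening x hε'
  have hx : x ∈ Metric.ball x (min δ₁ δ₂) := Metric.mem_ball_self (lt_min hδ₁ hδ₂)
  have hev : ∀ᶠ s in 𝓝[>] (0 : ℝ), x + s • h ∈ Metric.ball x (min δ₁ δ₂) := by
    have hc : Tendsto (fun s : ℝ => x + s • h) (𝓝 0) (𝓝 x) := by
      have : Continuous fun s : ℝ => x + s • h := by fun_prop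
      simpa using this.tendsto 0
    exact (hc.mono_left nhdsWithin_le_nhds).eventually (Metric.isOpen_ball.mem_nhds hx)
  filter_upwards [hev, self_mem_nhdsWithin] with s hs hs0
  have hs0 : 0 < s := hs0
  refine (hK.mono (Metric.ball_subset_ball (min_le_left _ _))).sub_le_of_inner_gradient_le
    Metric.isOpen_ball (convex_ball _ _) (fun u hu hd => ?_) hx hs
  have h1 := hgrad u (Metric.ball_subset_ball (min_le_right _ _) hu) hd
  rw [(hf.isCompact_clarkeSubdifferential x).cthickening_eq_biUnion_closedBall hε'.le] at h1
  simp only [Set.mem_iUnion, Metric.mem_closedBall, exists_prop] at h1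
  obtain ⟨w, hw, hdist⟩ := h1
  rw [inner_smul_right]
  refine mul_le_mul_of_nonneg_left ?_ hs0.le
  have h2 : inner ℝ (gradient f u - w) h ≤ ε := by
    refine (real_inner_le_norm _ _).trans ?_
    rw [← dist_eq_norm]
    calc dist (gradient f u) w * ‖h‖ ≤ ε / (‖h‖ + 1) * (‖h‖ + 1) := by
          gcongr; linarith
      _ = ε := by field_simp
  rw [inner_sub_left] at h2
  linarith [ha w hw]

end Clarke

/-! ### Optimality condition for the proximal step -/

section Prox

variable {E : Type*} [NormedAddCommGroup E] [InnerProductSpace ℝ E]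

/-- The cone `{r • (z - y) : r ≥ 0, z ∈ C}` of feasible directions of a convex set is convex. -/
theorem _root_.Convex.feasibleDirections {C : Set E} (hC : Convex ℝ C) (y : E) :
    Convex ℝ {k : E | ∃ r : ℝ, 0 ≤ r ∧ ∃ z ∈ C, k = r • (z - y)} := by
  rintro _ ⟨r, hr, z, hz, rfl⟩ _ ⟨s, hs, w, hw, rfl⟩ a b ha hb _
  have har : 0 ≤ a * r := mul_nonneg ha hr
  have hbs : 0 ≤ b * s := mul_nonneg hb hs
  rcases (add_nonneg har hbs).eq_or_lt with h0 | h0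
  · have h1 : a * r = 0 := by linarith
    have h2 : b * s = 0 := by linarith
    exact ⟨0, le_rfl, z, hz, by simp [smul_smul, h1, h2]⟩
  · refine ⟨a * r + b * s, h0.le, (a * r / (a * r + b * s)) • z + (b * s / (a * r + b * s)) • w,
      hC hz hw (by positivity) (by positivity) (by field_simp), ?_⟩
    rw [smul_sub (a * r + b * s), smul_add, smul_smul (a * r + b * s), smul_smul (a * r + b * s),
      mul_div_cancel₀ _ h0.ne',
      mul_div_cancel₀ _ h0.ne']
    module

/-- If `h` is nonnegative on the polar of the feasible directions of `C` at `y`, then `h` is a limit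
of feasible directions. -/
theorem mem_closure_feasibleDirections [CompleteSpace E] {C : Set E} (hC : Convex ℝ C) {y h : E}
    (hy : y ∈ C) (hh : ∀ n : E, (∀ z ∈ C, 0 ≤ inner ℝ n (z - y)) → 0 ≤ inner ℝ n h) :
    h ∈ closure {k : E | ∃ r : ℝ, 0 ≤ r ∧ ∃ z ∈ C, k = r • (z - y)} := by
  by_contra hcon
  obtain ⟨l, u, hlu, hul⟩ := geometric_hahn_banach_point_closed
    (hC.feasibleDirections y).closure isClosed_closure hcon
  have hu0 : u < 0 := by
    have := hul 0 (subset_closure ⟨0, le_rfl, y, hy, by simp⟩)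
    simpa using this
  have hn : ∀ z ∈ C, 0 ≤ inner ℝ ((InnerProductSpace.toDual ℝ E).symm l) (z - y) := by
    intro z hz
    rw [InnerProductSpace.toDual_symm_apply]
    by_contra! hneg
    -- The cone is stable under nonnegative scaling, and this multiple has `l`-value exactly `u`,
    -- which strict separation forbids.
    have := hul ((u / l (z - y)) • (z - y))
      (subset_closure ⟨_, div_nonneg_of_nonpos hu0.le hneg.le, z, hz, rfl⟩)
    rw [map_smul, smul_eq_mul, div_mul_cancel₀ _ hneg.ne] at this
    exact lt_irrefl _ this
  have := hh _ hn
  rw [InnerProductSpace.toDual_symm_apply] at this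
  linarith

/-- A minimax principle: if for every feasible direction `z - y` some point of the compact convex
set `A` has an almost nonnegative inner product with it, then one point of `A` has a nonnegative
inner product with all feasible directions. -/
theorem exists_inner_sub_nonneg_of_forall_exists [CompleteSpace E] {C A : Set E} (hC : Convex ℝ C)
    {y : E} (hy : y ∈ C) (hA : IsCompact A) (hAc : Convex ℝ A)
    (h : ∀ z ∈ C, ∀ c > 0, ∃ a ∈ A, -c < inner ℝ a (z - y)) :
    ∃ a ∈ A, ∀ z ∈ C, 0 ≤ inner ℝ a (z - y) := by
  by_contra! hcon
  let N : Set E := {n : E | ∀ z ∈ C, 0 ≤ inner ℝ n (z - y)}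
  have hNeq : N = ⋂ z ∈ C, {n : E | 0 ≤ inner ℝ n (z - y)} := by
    ext n; simp [N]
  have hNcl : IsClosed N := by
    rw [hNeq]
    exact isClosed_biInter fun z _ => isClosed_le continuous_const (by fun_prop)
  have hNc : Convex ℝ N := by
    intro n hn m hm a b ha hb _ z hz
    rw [inner_add_left, inner_smul_left, inner_smul_left]
    have h1 := mul_nonneg ha (hn z hz)
    have h2 := mul_nonneg hb (hm z hz)
    simpa using add_nonneg h1 h2
  -- The failure of the claim says that `A` misses the closed dual cone `N`. A separating vector
  -- `k₀` is nonnegative on `N`, hence by the bipolar argument a limit of feasible directions, and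
  -- one such direction will contradict `h`.
  have hdisj : Disjoint A N := by
    rw [Set.disjoint_left]
    intro a ha haN
    obtain ⟨z, hz, hlt⟩ := hcon a ha
    exact (haN z hz).not_gt hlt
  obtain ⟨l, s, t, hls, hst, hlt⟩ := geometric_hahn_banach_compact_closed hAc hA hNc hNcl hdisj
  have ht0 : t < 0 := by
    have := hlt 0 (fun z _ => by simp)
    simpa using this
  obtain ⟨k₀, hk₀⟩ : ∃ k₀, k₀ = (InnerProductSpace.toDual ℝ E).symm l := ⟨_, rfl⟩
  have hl : ∀ a, l a = inner ℝ a k₀ := fun a => by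
    rw [hk₀, real_inner_comm, InnerProductSpace.toDual_symm_apply]
  have hpos : ∀ n : E, (∀ z ∈ C, 0 ≤ inner ℝ n (z - y)) → 0 ≤ inner ℝ n k₀ := by
    intro n hn
    rw [← hl]
    by_contra! hneg
    have hmem : (t / l n) • n ∈ N := by
      intro z hz
      rw [inner_smul_left]
      exact mul_nonneg (by simpa using div_nonneg_of_nonpos ht0.le hneg.le) (hn z hz)
    have := hlt _ hmem
    rw [map_smul, smul_eq_mul, div_mul_cancel₀ _ hneg.ne] at this
    exact lt_irrefl _ this
  obtain ⟨R, hR⟩ := hA.isBounded.exists_norm_le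
  -- Approximating `k₀` this well keeps all inner products with `A` below `s / (|R| + 1) < 0`.
  have hε : 0 < (-s) / (|R| + 1) := by
    have : s < 0 := hst.trans ht0
    have : 0 < -s := by linarith
    positivity
  obtain ⟨_, ⟨r, hr, z, hz, rfl⟩, hdist⟩ :=
    Metric.mem_closure_iff.1 (mem_closure_feasibleDirections hC hy hpos) _ hε
  -- on `A`, the feasible direction `r • (z - y)` has negative inner products
  obtain ⟨a₀, ha₀, -⟩ := h y hy 1 one_pos
  have hneg : ∀ a ∈ A, r * inner ℝ a (z - y) < s + |R| * ((-s) / (|R| + 1)) := by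
    intro a ha
    have h1 : inner ℝ a k₀ < s := by rw [← hl]; exact hls a ha
    have h2 : inner ℝ a (r • (z - y) - k₀) ≤ |R| * ((-s) / (|R| + 1)) := by
      refine (real_inner_le_norm _ _).trans ?_
      rw [← dist_eq_norm, dist_comm]
      exact mul_le_mul ((hR a ha).trans (le_abs_self R)) hdist.le dist_nonneg (abs_nonneg R)
    rw [inner_sub_right, inner_smul_right] at h2
    linarith
  have hval : s + |R| * ((-s) / (|R| + 1)) = s / (|R| + 1) := by
    field_simp; ring
  rw [hval] at hneg
  have hs' : s / (|R| + 1) < 0 := div_neg_of_neg_of_pos (hst.trans ht0) (by positivity)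
  have hr0 : 0 < r := by
    rcases hr.eq_or_lt with h0 | h0
    · have := hneg a₀ ha₀
      rw [← h0, zero_mul] at this
      linarith
    · exact h0
  obtain ⟨a, ha, hlt'⟩ := h z hz (-(s / (|R| + 1)) / r) (div_pos (by linarith) hr0)
  have h3 := hneg a ha
  have h4 := mul_lt_mul_of_pos_left hlt' hr0
  have h5 : r * -(-(s / (|R| + 1)) / r) = s / (|R| + 1) := by field_simp
  linarith

/-- First order optimality condition for the proximal operator. -/
theorem exists_clarkeSubgradient_of_mem_prox [FiniteDimensional ℝ E] {g : E → ℝ}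
    (hg : LocallyLipschitz g) {C : Set E} (hC : Convex ℝ C) {γ : ℝ} (hγ : 0 < γ) {p y : E}
    (hy : y ∈ prox g C γ p) :
    ∃ w ∈ clarkeSubdifferential g y, ∀ z ∈ C, inner ℝ (y - p + γ • w) (y - z) ≤ 0 := by
  obtain ⟨hyC, hmin⟩ := hy
  have hcomp := hg.isCompact_clarkeSubdifferential y
  -- If every `a` had inner product at most `-c` with `z - y`, a short move from `y` towards `z`
  -- would decrease the objective: half of `c` pays for the error in the directional derivative of
  -- `g`, half for the quadratic term. The minimax lemma then gives one `w` for all `z`.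
  have key : ∀ z ∈ C, ∀ c > 0, ∃ a ∈ (γ⁻¹ • (y - p)) +ᵥ clarkeSubdifferential g y,
      -c < inner ℝ a (z - y) := by
    intro z hz c hc
    by_contra! hcon
    have hb : ∀ w ∈ clarkeSubdifferential g y,
        inner ℝ w (z - y) ≤ -c - inner ℝ (γ⁻¹ • (y - p)) (z - y) := by
      intro w hw
      have := hcon _ (Set.vadd_mem_vadd_set hw)
      rw [vadd_eq_add, inner_add_left] at this
      linarith
    have h1 := hg.eventually_sub_le_of_inner_le hb (half_pos hc)
    have hsm : ∀ᶠ s in 𝓝[>] (0 : ℝ), s * (1 / (2 * γ) * ‖z - y‖ ^ 2) < c / 2 := by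
      have : Continuous fun s : ℝ => s * (1 / (2 * γ) * ‖z - y‖ ^ 2) := by fun_prop
      have ht := this.tendsto 0
      rw [zero_mul] at ht
      exact (ht.mono_left nhdsWithin_le_nhds).eventually (gt_mem_nhds (half_pos hc))
    have hle1 : ∀ᶠ s in 𝓝[>] (0 : ℝ), s < 1 :=
      nhdsWithin_le_nhds (gt_mem_nhds one_pos)
    obtain ⟨s, h1, h2, hs1, hs0⟩ :=
      (h1.and (hsm.and (hle1.and self_mem_nhdsWithin))).exists
    have hs0 : 0 < s := hs0
    have hmem : y + s • (z - y) ∈ C := hC.add_smul_sub_mem hyC hz ⟨hs0.le, hs1.le⟩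
    have hm : g y + 1 / (2 * γ) * ‖y - p‖ ^ 2 ≤
        g (y + s • (z - y)) + 1 / (2 * γ) * ‖y + s • (z - y) - p‖ ^ 2 := hmin hmem
    have hexp : ‖y + s • (z - y) - p‖ ^ 2 =
        ‖y - p‖ ^ 2 + 2 * s * inner ℝ (y - p) (z - y) + s ^ 2 * ‖z - y‖ ^ 2 := by
      rw [show y + s • (z - y) - p = (y - p) + s • (z - y) by abel, norm_add_sq_real,
        inner_smul_right, norm_smul, mul_pow, Real.norm_eq_abs, sq_abs]
      ring
    rw [hexp] at hm
    rw [inner_smul_left] at h1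
    simp only [conj_trivial] at h1
    have h3 : 1 / (2 * γ) * (‖y - p‖ ^ 2 + 2 * s * inner ℝ (y - p) (z - y) + s ^ 2 * ‖z - y‖ ^ 2) =
        1 / (2 * γ) * ‖y - p‖ ^ 2 + s * (γ⁻¹ * inner ℝ (y - p) (z - y)) +
          s * (s * (1 / (2 * γ) * ‖z - y‖ ^ 2)) := by
      field_simp
    have h4 := mul_lt_mul_of_pos_left h2 hs0
    rw [h3] at hm
    nlinarith
  obtain ⟨a, ⟨w, hw, rfl⟩, ha⟩ := exists_inner_sub_nonneg_of_forall_exists hC hyC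
    (hcomp.vadd _) ((convex_clarkeSubdifferential g y).vadd _) key
  refine ⟨w, hw, fun z hz => ?_⟩
  have := mul_nonneg hγ.le (ha z hz)
  have h2 : γ * inner ℝ (γ⁻¹ • (y - p) +ᵥ w) (z - y) = - inner ℝ (y - p + γ • w) (y - z) := by
    rw [← neg_sub z y, inner_neg_right, neg_neg, vadd_eq_add, ← real_inner_smul_left, smul_add,
      smul_smul, mul_inv_cancel₀ hγ.ne', one_smul]
  simp only at this
  linarith

end Prox

/-! ### Errors vanishing on windows of bounded length -/

section Windows

/-- The increments of `S` over windows `[n, m)` of bounded `γ`-length vanish as `n → ∞`. -/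
def VanishesOnWindows {F : Type*} [NormedAddCommGroup F] (γ : ℕ → ℝ) (S : ℕ → F) : Prop :=
  ∀ T : ℝ, ∀ ε > 0, ∃ n₀, ∀ n ≥ n₀, ∀ m ≥ n,
    ∑ k ∈ Finset.Ico n m, γ k ≤ T → ‖S m - S n‖ ≤ ε

theorem VanishesOnWindows.tendsto {F : Type*} [NormedAddCommGroup F] {γ : ℕ → ℝ} {S : ℕ → F}
    (hS : VanishesOnWindows γ S) {a b : ℕ → ℕ} (ha : Tendsto a atTop atTop) (hab : ∀ j, a j ≤ b j)
    {l : ℝ} (hl : Tendsto (fun j => ∑ k ∈ Finset.Ico (a j) (b j), γ k) atTop (𝓝 l)) :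
    Tendsto (fun j => ‖S (b j) - S (a j)‖) atTop (𝓝 0) := by
  rw [Metric.tendsto_nhds]
  intro ε hε
  obtain ⟨n₀, hn₀⟩ := hS (l + 1) (ε / 2) (half_pos hε)
  filter_upwards [ha.eventually_ge_atTop n₀, hl.eventually (gt_mem_nhds (lt_add_one l))]
    with j h1 h2
  have := hn₀ _ h1 _ (hab j) h2.le
  simp only [dist_zero_right, norm_norm]
  linarith

end Windows

/-! ### Energy inequality and displacement bound for approximate paths -/

section Paths

variable {E : Type*} [NormedAddCommGroup E] [InnerProductSpace ℝ E]

/-- Bounded sequences satisfying a discrete evolution variational inequality on `C` with bounded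
drifts `b`, up to errors `M`, `N`, `Q` that vanish on windows. -/
structure IsApproximatePath (C : Set E) (γ : ℕ → ℝ) (x b M : ℕ → E) (N Q : ℕ → ℝ) (R L : ℝ) :
    Prop where
  pos : ∀ n, 0 < γ n
  mem : ∀ n, x (n + 1) ∈ C
  norm_le : ∀ n, ‖x n‖ ≤ R
  norm_drift_le : ∀ n, ‖b n‖ ≤ L
  energy : ∀ n, ∀ z ∈ C, 1 / 2 * ‖x (n + 1) - z‖ ^ 2 ≤ 1 / 2 * ‖x n - z‖ ^ 2
    - γ n * inner ℝ (b n) (x (n + 1) - z) + (N (n + 1) - N n)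
    - inner ℝ (M (n + 1) - M n) z + 1 / 2 * (Q (n + 1) - Q n)
  vanishes_M : VanishesOnWindows γ M
  vanishes_N : VanishesOnWindows γ N
  vanishes_Q : VanishesOnWindows γ Q

/-- One step of the energy estimate. -/
theorem half_norm_sub_sq_le_of_inner_nonpos {x x' b ξ z : E} {γ : ℝ}
    (h : inner ℝ (x' - x + γ • b - γ • ξ) (x' - z) ≤ 0) :
    1 / 2 * ‖x' - z‖ ^ 2 ≤ 1 / 2 * ‖x - z‖ ^ 2 - γ * inner ℝ b (x' - z)
      + γ * inner ℝ ξ x - inner ℝ (γ • ξ) z + 1 / 2 * (γ ^ 2 * ‖ξ‖ ^ 2) := by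
  have h1 : ‖x - z‖ ^ 2 = ‖x' - z‖ ^ 2 - 2 * inner ℝ (x' - x) (x' - z) + ‖x' - x‖ ^ 2 := by
    rw [show x - z = (x' - z) - (x' - x) by abel, norm_sub_sq_real, real_inner_comm]
  have h2 : inner ℝ (x' - x + γ • b - γ • ξ) (x' - z) = inner ℝ (x' - x) (x' - z)
      + γ * inner ℝ b (x' - z) - γ * inner ℝ ξ (x' - x) - γ * inner ℝ ξ x + γ * inner ℝ ξ z := by
    simp only [inner_sub_left, inner_add_left, inner_sub_right, real_inner_smul_left]
    ring
  -- The noise is correlated with `x'`; the part `⟪ξ, x' - x⟫` is absorbed by the square `‖x' - x‖ ^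
  -- 2`, leaving only `⟪ξ, x⟫`, where `x` is predictable, and `γ² ‖ξ‖²`.
  have h3 : 0 ≤ ‖x' - x‖ ^ 2 - 2 * (γ * inner ℝ ξ (x' - x)) + γ ^ 2 * ‖ξ‖ ^ 2 := by
    have := sq_nonneg ‖(x' - x) - γ • ξ‖
    rw [norm_sub_sq_real, inner_smul_right, real_inner_comm, norm_smul, mul_pow, Real.norm_eq_abs,
      sq_abs] at this
    exact this
  rw [real_inner_smul_left]
  linarith

namespace IsApproximatePath

variable {C : Set E} {γ : ℕ → ℝ} {x b M : ℕ → E} {N Q : ℕ → ℝ} {R L : ℝ}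

/-- The one-step errors are increments, so they telescope; the factor `1 + ‖z‖` accounts for the
pairing of `M` with `z`. -/
theorem energy_window (h : IsApproximatePath C γ x b M N Q R L) {n m : ℕ} (hnm : n ≤ m) {z : E}
    (hz : z ∈ C) :
    1 / 2 * ‖x m - z‖ ^ 2 ≤ 1 / 2 * ‖x n - z‖ ^ 2
      - ∑ k ∈ Finset.Ico n m, γ k * inner ℝ (b k) (x (k + 1) - z)
      + (‖N m - N n‖ + ‖M m - M n‖ + ‖Q m - Q n‖) * (1 + ‖z‖) := by
  have key : 1 / 2 * ‖x m - z‖ ^ 2 ≤ 1 / 2 * ‖x n - z‖ ^ 2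
      - ∑ k ∈ Finset.Ico n m, γ k * inner ℝ (b k) (x (k + 1) - z)
      + (N m - N n) - inner ℝ (M m - M n) z + 1 / 2 * (Q m - Q n) := by
    induction m, hnm using Nat.le_induction with
    | base => simp
    | succ m hm ih =>
      have := h.energy m z hz
      rw [Finset.sum_Ico_succ_top hm]
      have h2 : inner ℝ (M (m + 1) - M n) z
          = inner ℝ (M (m + 1) - M m) z + inner ℝ (M m - M n) z := by
        rw [← inner_add_left]; congr 1; abel
      linarith
  have h1 : N m - N n ≤ ‖N m - N n‖ := le_abs_self _
  have h2 : Q m - Q n ≤ ‖Q m - Q n‖ := le_abs_self _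
  have h3 : -inner ℝ (M m - M n) z ≤ ‖M m - M n‖ * ‖z‖ :=
    (neg_le_abs _).trans (abs_real_inner_le_norm _ _)
  have h4 := mul_nonneg (norm_nonneg (N m - N n)) (norm_nonneg z)
  have h5 := mul_nonneg (norm_nonneg (Q m - Q n)) (norm_nonneg z)
  have h6 := norm_nonneg (M m - M n)
  have h7 := norm_nonneg (Q m - Q n)
  nlinarith

theorem bound_nonneg (h : IsApproximatePath C γ x b M N Q R L) : 0 ≤ R :=
  (norm_nonneg _).trans (h.norm_le 0)

theorem drift_bound_nonneg (h : IsApproximatePath C γ x b M N Q R L) : 0 ≤ L :=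
  (norm_nonneg _).trans (h.norm_drift_le 0)

/-- Testing the energy inequality with `z = x n` at the farthest point of the window gives `S ^ 2 ≤
2 Δ L S + ε ^ 2` for the maximal displacement `S`, hence `S ≤ 2 L Δ + ε`. No bound on normal vectors
is needed. -/
theorem norm_sub_le (h : IsApproximatePath C γ x b M N Q R L) (T : ℝ) {ε : ℝ} (hε : 0 < ε) :
    ∃ n₀, ∀ n ≥ n₀, ∀ m ≥ n, ∑ k ∈ Finset.Ico n m, γ k ≤ T →
      ‖x m - x n‖ ≤ 2 * L * ∑ k ∈ Finset.Ico n m, γ k + ε := by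
  have hR := h.bound_nonneg
  have hL := h.drift_bound_nonneg
  have hε' : 0 < ε ^ 2 / (6 * (1 + R)) := by positivity
  obtain ⟨n₁, h₁⟩ := h.vanishes_M T _ hε'
  obtain ⟨n₂, h₂⟩ := h.vanishes_N T _ hε'
  obtain ⟨n₃, h₃⟩ := h.vanishes_Q T _ hε'
  -- The `1` ensures `x n ∈ C`, so that it is admissible as a test point; the starting point `x 0`
  -- need not lie in `C`.
  refine ⟨max 1 (max n₁ (max n₂ n₃)), fun n hn m hm hT => ?_⟩
  simp only [ge_iff_le, max_le_iff] at hn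
  obtain ⟨hn0, hn1, hn2, hn3⟩ := hn
  have hxn : x n ∈ C := by
    obtain ⟨k, rfl⟩ := Nat.exists_eq_add_of_le' hn0
    exact h.mem k
  obtain ⟨j, hj, hmax⟩ := Finset.exists_max_image (Finset.Icc n m) (fun j => ‖x j - x n‖)
    ⟨n, by simpa using hm⟩
  rw [Finset.mem_Icc] at hj
  have hsub : ∑ k ∈ Finset.Ico n j, γ k ≤ ∑ k ∈ Finset.Ico n m, γ k :=
    Finset.sum_le_sum_of_subset_of_nonneg (Finset.Ico_subset_Ico_right hj.2)
      fun k _ _ => (h.pos k).le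
  have hΔ : 0 ≤ ∑ k ∈ Finset.Ico n m, γ k := Finset.sum_nonneg fun k _ => (h.pos k).le
  set Δ := ∑ k ∈ Finset.Ico n m, γ k with hΔdef
  set S := ‖x j - x n‖ with hS
  have hS0 : 0 ≤ S := norm_nonneg _
  have he := h.energy_window hj.1 hxn
  have hd : -∑ k ∈ Finset.Ico n j, γ k * inner ℝ (b k) (x (k + 1) - x n) ≤ Δ * (L * S) := by
    calc -∑ k ∈ Finset.Ico n j, γ k * inner ℝ (b k) (x (k + 1) - x n)
        = ∑ k ∈ Finset.Ico n j, γ k * -inner ℝ (b k) (x (k + 1) - x n) := by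
          rw [← Finset.sum_neg_distrib]; simp
      _ ≤ ∑ k ∈ Finset.Ico n j, γ k * (L * S) := by
          refine Finset.sum_le_sum fun k hk => mul_le_mul_of_nonneg_left ?_ (h.pos k).le
          rw [Finset.mem_Ico] at hk
          refine (neg_le_abs _).trans ((abs_real_inner_le_norm _ _).trans ?_)
          exact mul_le_mul (h.norm_drift_le k)
            (hmax (k + 1) (Finset.mem_Icc.2 ⟨by omega, by omega⟩)) (norm_nonneg _) hL
      _ = (∑ k ∈ Finset.Ico n j, γ k) * (L * S) := by rw [Finset.sum_mul]
      _ ≤ Δ * (L * S) := by gcongr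
  have herr : (‖N j - N n‖ + ‖M j - M n‖ + ‖Q j - Q n‖) * (1 + ‖x n‖) ≤ ε ^ 2 / 2 := by
    have hT' := hsub.trans hT
    calc _ ≤ (ε ^ 2 / (6 * (1 + R)) + ε ^ 2 / (6 * (1 + R)) + ε ^ 2 / (6 * (1 + R))) * (1 + R) := by
          gcongr
          · exact h₂ n hn2 j hj.1 hT'
          · exact h₁ n hn1 j hj.1 hT'
          · exact h₃ n hn3 j hj.1 hT'
          · exact h.norm_le n
      _ = ε ^ 2 / 2 := by field_simp; ring
  have hquad : S ^ 2 ≤ 2 * (Δ * (L * S)) + ε ^ 2 := by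
    have : ‖x n - x n‖ = 0 := by simp
    rw [this] at he
    linarith
  have hSle : S ≤ 2 * L * Δ + ε := by
    by_contra! hlt
    have h0 : 0 ≤ 2 * L * Δ := by positivity
    have h1 : ε ≤ S := by linarith
    nlinarith [mul_lt_mul_of_pos_right hlt (lt_of_lt_of_le hε h1),
      mul_le_mul_of_nonneg_left h1 hε.le]
  exact (hmax m (Finset.mem_Icc.2 ⟨hm, le_rfl⟩)).trans hSle

theorem norm_succ_sub_tendsto (h : IsApproximatePath C γ x b M N Q R L)
    (hγ : Tendsto γ atTop (𝓝 0)) : Tendsto (fun n => ‖x (n + 1) - x n‖) atTop (𝓝 0) := by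
  rw [Metric.tendsto_nhds]
  intro ε hε
  obtain ⟨n₀, hn₀⟩ := h.norm_sub_le 1 (half_pos hε)
  have h1 : Tendsto (fun n => 2 * L * γ n) atTop (𝓝 0) := by simpa using hγ.const_mul (2 * L)
  filter_upwards [eventually_ge_atTop n₀, hγ.eventually (gt_mem_nhds one_pos),
    h1.eventually (gt_mem_nhds (half_pos hε))] with n hn hn1 hn2
  have := hn₀ n hn (n + 1) (Nat.le_succ n) (by simpa using hn1.le)
  rw [Nat.Ico_succ_singleton, Finset.sum_singleton] at this
  simp only [dist_zero_right, norm_norm]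
  linarith

end IsApproximatePath

end Paths

/-! ### Discrete and continuous time -/

section TimeIndex

variable {E : Type*} [NormedAddCommGroup E] [InnerProductSpace ℝ E]
variable {γ : ℕ → ℝ}

theorem tau_timeIndex_le_and_lt (hγ : ∀ n, 0 < γ n)
    (hdiv : Tendsto (fun n => ∑ i ∈ Finset.range n, γ i) atTop atTop) {t : ℝ} (ht : 0 ≤ t) :
    tau γ (timeIndex γ t) ≤ t ∧ t < tau γ (timeIndex γ t + 1) := by
  obtain ⟨n, hn⟩ := ((tendsto_tau hdiv).eventually_gt_atTop t).exists
  have hbdd : BddAbove {n : ℕ | tau γ n ≤ t} :=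
    ⟨n, fun k hk => ((tau_strictMono hγ).lt_iff_lt.1 (lt_of_le_of_lt hk hn)).le⟩
  have hne : {n : ℕ | tau γ n ≤ t}.Nonempty := ⟨0, by simpa [tau] using ht⟩
  refine ⟨Nat.sSup_mem hne hbdd, ?_⟩
  by_contra! hcon
  exact absurd (le_csSup hbdd hcon) (by simp [timeIndex])

theorem timeIndex_mono (hγ : ∀ n, 0 < γ n)
    (hdiv : Tendsto (fun n => ∑ i ∈ Finset.range n, γ i) atTop atTop) {s t : ℝ} (hs : 0 ≤ s)
    (hst : s ≤ t) : timeIndex γ s ≤ timeIndex γ t := by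
  have h1 := (tau_timeIndex_le_and_lt hγ hdiv hs).1
  have h2 := (tau_timeIndex_le_and_lt hγ hdiv (hs.trans hst)).2
  exact Nat.lt_succ_iff.1 ((tau_strictMono hγ).lt_iff_lt.1 (h1.trans_lt (hst.trans_lt h2)))

theorem tendsto_timeIndex (hγ : ∀ n, 0 < γ n)
    (hdiv : Tendsto (fun n => ∑ i ∈ Finset.range n, γ i) atTop atTop) :
    Tendsto (timeIndex γ) atTop atTop := by
  rw [tendsto_atTop]
  intro n
  filter_upwards [eventually_ge_atTop (tau γ n), eventually_ge_atTop 0] with t ht ht0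
  have h2 := (tau_timeIndex_le_and_lt hγ hdiv ht0).2
  exact Nat.lt_succ_iff.1 ((tau_strictMono hγ).lt_iff_lt.1 (ht.trans_lt h2))

/-- The step from `x k` to `x (k + 1)` has size `γ k` in the scheme but takes time `γ (k + 1)` in
the interpolation. The two clocks differ only by boundary terms, which vanish as `γ → 0`. -/
theorem sum_Ico_eq_tau_sub {n m : ℕ} (hnm : n ≤ m) :
    ∑ k ∈ Finset.Ico n m, γ k = tau γ m - tau γ n + γ n - γ m := by
  induction m, hnm using Nat.le_induction with
  | base => simp
  | succ m hm ih => rw [Finset.sum_Ico_succ_top hm, ih, tau_succ]; ring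

theorem norm_interpolation_sub_le (hγ : ∀ n, 0 < γ n)
    (hdiv : Tendsto (fun n => ∑ i ∈ Finset.range n, γ i) atTop atTop) (x : ℕ → E) {t : ℝ}
    (ht : 0 ≤ t) : ‖interpolation γ x t - x (timeIndex γ t)‖
      ≤ ‖x (timeIndex γ t + 1) - x (timeIndex γ t)‖ := by
  obtain ⟨h1, h2⟩ := tau_timeIndex_le_and_lt hγ hdiv ht
  rw [interpolation, add_sub_cancel_left, norm_smul]
  refine mul_le_of_le_one_left (norm_nonneg _) ?_
  rw [tau_succ] at h2
  have hp := hγ (timeIndex γ t + 1)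
  rw [Real.norm_eq_abs, abs_of_nonneg (div_nonneg (sub_nonneg.2 h1) hp.le), div_le_one hp]
  linarith

/-- The `γ`-length of the window between two times converges to the difference of the times. -/
theorem tendsto_sum_Ico_timeIndex (hγ : ∀ n, 0 < γ n)
    (hdiv : Tendsto (fun n => ∑ i ∈ Finset.range n, γ i) atTop atTop)
    (hγ0 : Tendsto γ atTop (𝓝 0)) {ι : Type*} {l : Filter ι} {s t : ι → ℝ} (hs0 : ∀ j, 0 ≤ s j)
    (hst : ∀ j, s j ≤ t j) (hs : Tendsto s l atTop) :
    Tendsto (fun j => ∑ k ∈ Finset.Ico (timeIndex γ (s j)) (timeIndex γ (t j)), γ k - (t j - s j))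
      l (𝓝 0) := by
  have ht : Tendsto t l atTop := tendsto_atTop_mono hst hs
  have key : ∀ {r : ι → ℝ}, Tendsto r l atTop →
      Tendsto (fun j => γ (timeIndex γ (r j))) l (𝓝 0) := fun hr =>
    hγ0.comp ((tendsto_timeIndex hγ hdiv).comp hr)
  have key1 : ∀ {r : ι → ℝ}, Tendsto r l atTop →
      Tendsto (fun j => γ (timeIndex γ (r j) + 1)) l (𝓝 0) := fun hr =>
    (hγ0.comp (tendsto_add_atTop_nat 1)).comp ((tendsto_timeIndex hγ hdiv).comp hr)
  have hlag : ∀ {r : ι → ℝ}, (∀ j, 0 ≤ r j) → Tendsto r l atTop →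
      Tendsto (fun j => r j - tau γ (timeIndex γ (r j))) l (𝓝 0) := by
    intro r hr0 hr
    refine squeeze_zero (fun j => ?_) (fun j => ?_) (key1 hr)
    · exact sub_nonneg.2 (tau_timeIndex_le_and_lt hγ hdiv (hr0 j)).1
    · have := (tau_timeIndex_le_and_lt hγ hdiv (hr0 j)).2
      rw [tau_succ] at this
      linarith
  have h := ((hlag hs0 hs).sub (hlag (fun j => (hs0 j).trans (hst j)) ht)).add
    ((key hs).sub (key ht))
  simp only [sub_zero, add_zero] at h
  refine h.congr fun j => ?_
  rw [sum_Ico_eq_tau_sub (timeIndex_mono hγ hdiv (hs0 j) (hst j))]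
  ring

end TimeIndex

/-! ### Relative compactness of shifts -/

section Compactness

variable {E : Type*} [NormedAddCommGroup E] [InnerProductSpace ℝ E]

/-- The shifts of a bounded uniformly continuous curve form a relatively compact family. -/
theorem isCompact_closure_range_shift [FiniteDimensional ℝ E] {X : C(ℝ≥0, E)}
    (hX : UniformContinuous X) {R : ℝ} (hR : ∀ t, ‖X t‖ ≤ R) :
    IsCompact (closure (Set.range (shift X))) := by
  -- Arzelà–Ascoli is applied inside all functions with uniform convergence on compacts, where the
  -- continuous ones form a closed set.
  have hemb : IsClosedEmbedding
      (UniformOnFun.ofFun {K : Set ℝ≥0 | IsCompact K} ∘ (fun f : C(ℝ≥0, E) => (f : ℝ≥0 → E))) := by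
    refine ⟨ContinuousMap.isUniformEmbedding_toUniformOnFunIsCompact.isEmbedding, ?_⟩
    have := ContinuousMap.range_toUniformOnFunIsCompact (α := ℝ≥0) (β := E)
    change IsClosed (Set.range (ContinuousMap.toUniformOnFunIsCompact (α := ℝ≥0) (β := E)))
    rw [this]
    exact UniformOnFun.isClosed_setOfPred_continuous CompactlyCoherentSpace.isCoherentWith
  refine ArzelaAscoli.isCompact_closure_of_isClosedEmbedding (fun K hK => hK) hemb ?_ ?_
  · intro K _
    refine Equicontinuous.equicontinuousOn (fun s => ?_) K
    rw [Metric.equicontinuousAt_iff]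
    intro ε hε
    obtain ⟨δ, hδ, h⟩ := Metric.uniformContinuous_iff.1 hX ε hε
    refine ⟨δ, hδ, ?_⟩
    rintro r hr ⟨_, t, rfl⟩
    refine h ?_
    rw [dist_comm, NNReal.dist_eq] at hr
    rw [NNReal.dist_eq, NNReal.coe_add, NNReal.coe_add, add_sub_add_left_eq_sub]
    exact hr
  · intro K _ s _
    refine ⟨Metric.closedBall 0 R, isCompact_closedBall _ _, ?_⟩
    rintro _ ⟨t, rfl⟩
    simpa [shift] using hR (t + s)

/-- A curve that is asymptotically Lipschitz is uniformly continuous. -/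
theorem uniformContinuous_of_asymptotically_lipschitz {F : Type*} [NormedAddCommGroup F]
    {X : ℝ≥0 → F} (hX : Continuous X) {B : ℝ}
    (hB : 0 ≤ B) (h : ∀ ε > 0, ∃ t₀ : ℝ≥0, ∀ s ≥ t₀, ∀ t ≥ s, (t : ℝ) - s ≤ 1 →
      ‖X t - X s‖ ≤ B * (t - s) + ε) : UniformContinuous X := by
  rw [Metric.uniformContinuous_iff]
  intro ε hε
  obtain ⟨t₀, ht₀⟩ := h (ε / 2) (half_pos hε)
  -- The extra unit of length lets any two times less than `1` apart lie together in this compact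
  -- interval or together beyond `t₀`.
  have hcomp : UniformContinuousOn X (Set.Icc 0 (t₀ + 1)) :=
    isCompact_Icc.uniformContinuousOn_of_continuous hX.continuousOn
  obtain ⟨δ, hδ, hunif⟩ := Metric.uniformContinuousOn_iff.1 hcomp ε hε
  have hδ' : 0 < min δ (min 1 (ε / (2 * (B + 1)))) := by positivity
  have key : ∀ s t : ℝ≥0, s ≤ t → dist s t < min δ (min 1 (ε / (2 * (B + 1)))) →
      dist (X s) (X t) < ε := by
    intro s t hst hd
    have hd1 := lt_min_iff.1 hd
    have hd2 := lt_min_iff.1 hd1.2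
    have hst' : (s : ℝ) ≤ t := by exact_mod_cast hst
    have hdist : dist s t = (t : ℝ) - s := by
      rw [NNReal.dist_eq, abs_sub_comm, abs_of_nonneg (sub_nonneg.2 hst')]
    rw [hdist] at hd1 hd2
    rcases le_total t₀ s with h0 | h0
    · have h1 := ht₀ s h0 t hst hd2.1.le
      rw [dist_comm, dist_eq_norm]
      refine h1.trans_lt ?_
      have h2 : B * ((t : ℝ) - s) < ε / 2 := by
        have h3 := (lt_div_iff₀ (by positivity)).1 hd2.2
        nlinarith [sub_nonneg.2 hst']
      linarith
    · refine hunif s ⟨zero_le, h0.trans (by simp)⟩ t ⟨zero_le, ?_⟩ (by rw [hdist]; exact hd1.1)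
      have h0' : (s : ℝ) ≤ t₀ := by exact_mod_cast h0
      rw [← NNReal.coe_le_coe]
      push_cast
      linarith [hd2.1]
  refine ⟨_, hδ', fun {s t} hst => ?_⟩
  rcases le_total s t with hle | hle
  · exact key s t hle hst
  · rw [dist_comm]
    rw [dist_comm] at hst
    exact key t s hle hst

end Compactness

/-! ### Compactness and Lipschitz limits of the interpolation -/

namespace IsApproximatePath

variable {E : Type*} [NormedAddCommGroup E] [InnerProductSpace ℝ E]
variable {C : Set E} {γ : ℕ → ℝ} {x b M : ℕ → E} {N Q : ℕ → ℝ} {R L : ℝ}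

theorem norm_interpolation_le (h : IsApproximatePath C γ x b M N Q R L)
    (hdiv : Tendsto (fun n => ∑ i ∈ Finset.range n, γ i) atTop atTop) {t : ℝ} (ht : 0 ≤ t) :
    ‖interpolation γ x t‖ ≤ 3 * R := by
  have h1 := norm_interpolation_sub_le h.pos hdiv x ht
  have h2 := _root_.norm_sub_le (x (timeIndex γ t + 1)) (x (timeIndex γ t))
  have h3 := norm_sub_norm_le (interpolation γ x t) (x (timeIndex γ t))
  linarith [h.norm_le (timeIndex γ t + 1), h.norm_le (timeIndex γ t)]

theorem tendsto_interpolation_sub (h : IsApproximatePath C γ x b M N Q R L)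
    (hdiv : Tendsto (fun n => ∑ i ∈ Finset.range n, γ i) atTop atTop)
    (hγ : Tendsto γ atTop (𝓝 0)) :
    Tendsto (fun t => ‖interpolation γ x t - x (timeIndex γ t)‖) atTop (𝓝 0) := by
  refine squeeze_zero' (Eventually.of_forall fun _ => norm_nonneg _) ?_
    ((h.norm_succ_sub_tendsto hγ).comp (tendsto_timeIndex h.pos hdiv))
  filter_upwards [eventually_ge_atTop 0] with t ht using norm_interpolation_sub_le h.pos hdiv x ht

theorem norm_interpolation_sub_le' (h : IsApproximatePath C γ x b M N Q R L)
    (hdiv : Tendsto (fun n => ∑ i ∈ Finset.range n, γ i) atTop atTop)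
    (hγ : Tendsto γ atTop (𝓝 0)) (T : ℝ) {ε : ℝ} (hε : 0 < ε) :
    ∃ t₀ : ℝ≥0, ∀ s : ℝ, t₀ ≤ s → ∀ t, s ≤ t → t - s ≤ T →
      ‖interpolation γ x t - interpolation γ x s‖ ≤ 2 * L * (t - s) + ε := by
  have hL := h.drift_bound_nonneg
  -- The window between the two time indices exceeds `t - s` by at most two step sizes, each
  -- eventually below `1`.
  obtain ⟨n₀, hn₀⟩ := h.norm_sub_le (T + 2) (show 0 < ε / 4 by positivity)
  have h4 : 0 < ε / 4 := by positivity
  have hγL : Tendsto (fun n => 2 * L * γ n) atTop (𝓝 0) := by simpa using hγ.const_mul (2 * L)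
  have htI := tendsto_timeIndex h.pos hdiv
  have hev : ∀ᶠ s : ℝ in atTop, n₀ ≤ timeIndex γ s ∧
      ‖interpolation γ x s - x (timeIndex γ s)‖ < ε / 4 ∧
      γ (timeIndex γ s) < 1 ∧ γ (timeIndex γ s + 1) < 1 ∧
      2 * L * γ (timeIndex γ s) < ε / 8 ∧ 2 * L * γ (timeIndex γ s + 1) < ε / 8 := by
    have hs := tendsto_add_atTop_nat 1
    filter_upwards [htI.eventually_ge_atTop n₀,
      (h.tendsto_interpolation_sub hdiv hγ).eventually (gt_mem_nhds h4),
      (hγ.comp htI).eventually (gt_mem_nhds one_pos),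
      ((hγ.comp hs).comp htI).eventually (gt_mem_nhds one_pos),
      (hγL.comp htI).eventually (gt_mem_nhds (show 0 < ε / 8 by positivity)),
      ((hγL.comp hs).comp htI).eventually (gt_mem_nhds (show 0 < ε / 8 by positivity))]
      with s h1 h2 h3 h4 h5 h6 using ⟨h1, h2, h3, h4, h5, h6⟩
  obtain ⟨t₀, ht₀⟩ := eventually_atTop.1 hev
  refine ⟨t₀.toNNReal, fun s hs t hst hT => ?_⟩
  have hs0 : 0 ≤ s := (NNReal.coe_nonneg _).trans hs
  have hs' : t₀ ≤ s := (Real.le_coe_toNNReal _).trans hs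
  obtain ⟨a1, a2, a3, a4, a5, a6⟩ := ht₀ s hs'
  obtain ⟨-, b2, -, -, -, -⟩ := ht₀ t (hs'.trans hst)
  have hle := timeIndex_mono h.pos hdiv hs0 hst
  have hI1 := tau_timeIndex_le_and_lt h.pos hdiv hs0
  have hI2 := tau_timeIndex_le_and_lt h.pos hdiv (hs0.trans hst)
  have hsum := sum_Ico_eq_tau_sub (γ := γ) hle
  have hsumle : ∑ k ∈ Finset.Ico (timeIndex γ s) (timeIndex γ t), γ k
      ≤ (t - s) + γ (timeIndex γ s + 1) + γ (timeIndex γ s) := by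
    have := h.pos (timeIndex γ t)
    rw [tau_succ] at hI1
    linarith
  have hmain := hn₀ _ a1 _ hle (by linarith)
  have hmul := mul_le_mul_of_nonneg_left hsumle (show 0 ≤ 2 * L by positivity)
  have htri : ‖interpolation γ x t - interpolation γ x s‖ ≤
      ‖interpolation γ x t - x (timeIndex γ t)‖ + ‖x (timeIndex γ t) - x (timeIndex γ s)‖
        + ‖interpolation γ x s - x (timeIndex γ s)‖ := by
    rw [← norm_neg (interpolation γ x s - x (timeIndex γ s))]
    refine le_trans (le_of_eq ?_) norm_add₃_le
    congr 1; abel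
  linarith

theorem isCompact_closure_range_shift [FiniteDimensional ℝ E]
    (h : IsApproximatePath C γ x b M N Q R L) (hpos : ∀ n, 0 < γ n)
    (hdiv : Tendsto (fun n => ∑ i ∈ Finset.range n, γ i) atTop atTop)
    (hγ : Tendsto γ atTop (𝓝 0)) :
    IsCompact (closure (Set.range (shift (interpolatedProcess γ hpos hdiv x)))) := by
  refine SPGD.isCompact_closure_range_shift ?_ fun t => h.norm_interpolation_le hdiv t.2
  refine uniformContinuous_of_asymptotically_lipschitz (ContinuousMap.continuous _)
    (mul_nonneg two_pos.le h.drift_bound_nonneg) fun ε hε => ?_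
  obtain ⟨t₀, ht₀⟩ := h.norm_interpolation_sub_le' hdiv hγ 1 hε
  exact ⟨t₀, fun s hs t hst hT => ht₀ s (by exact_mod_cast hs) t (by exact_mod_cast hst) hT⟩

/-- Limit curves of the shifted interpolations are Lipschitz. -/
theorem norm_limit_sub_le (h : IsApproximatePath C γ x b M N Q R L)
    (hdiv : Tendsto (fun n => ∑ i ∈ Finset.range n, γ i) atTop atTop)
    (hγ : Tendsto γ atTop (𝓝 0)) {t : ℕ → ℝ} (ht : Tendsto t atTop atTop)
    {Y : ℝ → E} (hY : ∀ s, 0 ≤ s → Tendsto (fun j => interpolation γ x (t j + s)) atTop (𝓝 (Y s)))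
    {s s' : ℝ} (hs : 0 ≤ s) (hss' : s ≤ s') : ‖Y s' - Y s‖ ≤ 2 * L * (s' - s) := by
  refine le_of_forall_pos_le_add fun ε hε => ?_
  obtain ⟨t₀, ht₀⟩ := h.norm_interpolation_sub_le' hdiv hγ (s' - s) hε
  refine le_of_tendsto ((hY s' (hs.trans hss')).sub (hY s hs)).norm ?_
  filter_upwards [ht.eventually_ge_atTop (t₀ : ℝ)] with j hj
  have := ht₀ (t j + s) (by linarith) (t j + s') (by linarith) (by linarith)
  rwa [add_sub_add_left_eq_sub] at this

end IsApproximatePath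

/-! ### The differential inclusion for limit curves -/

namespace IsApproximatePath

variable {E : Type*} [NormedAddCommGroup E] [InnerProductSpace ℝ E]
variable {C : Set E} {γ : ℕ → ℝ} {x v w M : ℕ → E} {N Q : ℕ → ℝ} {R L : ℝ}

/-- The energy estimate on a window which stays close to `c`, in terms of averaged drifts. -/
theorem exists_average_drift
    (h : IsApproximatePath C γ x (fun n => v n + w n) M N Q R L) {U W : Set E} (hUc : Convex ℝ U)
    (hWc : Convex ℝ W) {c : E} {ρ : ℝ} {n m : ℕ} (hnm : n < m)
    (hball : ∀ k, n ≤ k → k ≤ m → x k ∈ Metric.ball c ρ)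
    (hv : ∀ k, x k ∈ Metric.ball c ρ → v k ∈ U)
    (hw : ∀ k, x (k + 1) ∈ Metric.ball c ρ → w k ∈ W) :
    ∃ u' ∈ U, ∃ w' ∈ W, ∀ z ∈ C, 1 / 2 * ‖x m - z‖ ^ 2 - 1 / 2 * ‖x n - z‖ ^ 2 ≤
      (∑ k ∈ Finset.Ico n m, γ k) * (L * ρ - inner ℝ (u' + w') (c - z))
      + (‖N m - N n‖ + ‖M m - M n‖ + ‖Q m - Q n‖) * (1 + ‖z‖) := by
  have hne : (Finset.Ico n m).Nonempty := Finset.nonempty_Ico.2 hnm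
  have hΔ : 0 < ∑ k ∈ Finset.Ico n m, γ k := Finset.sum_pos (fun k _ => h.pos k) hne
  have hsm : ∀ y : ℕ → E, (∑ k ∈ Finset.Ico n m, γ k) • (Finset.Ico n m).centerMass γ y
      = ∑ k ∈ Finset.Ico n m, γ k • y k := fun y => by
    rw [Finset.centerMass, smul_smul, mul_inv_cancel₀ hΔ.ne', one_smul]
  -- The `γ`-weighted barycentres of the two drifts stay in `U` and `W` by convexity. They do not
  -- depend on `z`, so one pair serves all test points.
  refine ⟨(Finset.Ico n m).centerMass γ v, hUc.centerMass_mem (fun k _ => (h.pos k).le) hΔ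
      (fun k hk => ?_), (Finset.Ico n m).centerMass γ w,
      hWc.centerMass_mem (fun k _ => (h.pos k).le) hΔ (fun k hk => ?_), fun z hz => ?_⟩
  · rw [Finset.mem_Ico] at hk
    exact hv k (hball k hk.1 hk.2.le)
  · rw [Finset.mem_Ico] at hk
    exact hw k (hball (k + 1) (by omega) (by omega))
  have he := h.energy_window hnm.le hz
  have hd : -∑ k ∈ Finset.Ico n m, γ k * inner ℝ (v k + w k) (x (k + 1) - z) ≤
      (∑ k ∈ Finset.Ico n m, γ k) * (L * ρ - inner ℝ
        ((Finset.Ico n m).centerMass γ v + (Finset.Ico n m).centerMass γ w) (c - z)) := by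
    rw [mul_sub, ← real_inner_smul_left, smul_add, hsm, hsm, ← Finset.sum_add_distrib, sum_inner,
      Finset.sum_mul, ← Finset.sum_neg_distrib, ← Finset.sum_sub_distrib]
    refine Finset.sum_le_sum fun k hk => ?_
    rw [Finset.mem_Ico] at hk
    have h1 : ‖x (k + 1) - c‖ ≤ ρ := by
      have := hball (k + 1) (by omega) (by omega)
      rw [mem_ball_iff_norm] at this
      exact this.le
    -- Freezing the moving point `x (k + 1)` at `c` is what costs `L * ρ`.
    have h2 : -inner ℝ (v k + w k) (x (k + 1) - c) ≤ L * ρ :=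
      (neg_le_abs _).trans ((abs_real_inner_le_norm _ _).trans
        (mul_le_mul (h.norm_drift_le k) h1 (norm_nonneg _) h.drift_bound_nonneg))
    rw [← smul_add, real_inner_smul_left,
      show x (k + 1) - z = (x (k + 1) - c) + (c - z) by abel, inner_add_right]
    have h3 := mul_le_mul_of_nonneg_left h2 (h.pos k).le
    linarith
  linarith

/-- The evolution variational inequality for limit curves on short intervals. -/
theorem exists_limit_drift [FiniteDimensional ℝ E]
    (h : IsApproximatePath C γ x (fun n => v n + w n) M N Q R L)
    (hdiv : Tendsto (fun n => ∑ i ∈ Finset.range n, γ i) atTop atTop)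
    (hγ : Tendsto γ atTop (𝓝 0)) {t : ℕ → ℝ} (ht0 : ∀ j, 0 ≤ t j) (ht : Tendsto t atTop atTop)
    {Y : ℝ → E} (hY : ∀ s, 0 ≤ s → Tendsto (fun j => interpolation γ x (t j + s)) atTop (𝓝 (Y s)))
    {s s' : ℝ} (hs : 0 ≤ s) (hss' : s < s') {ρ : ℝ} (hρ : 2 * L * (s' - s) < ρ)
    {U W : Set E} (hU : IsCompact U) (hUc : Convex ℝ U) (hW : IsCompact W) (hWc : Convex ℝ W)
    (hv : ∀ k, x k ∈ Metric.ball (Y s) ρ → v k ∈ U)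
    (hw : ∀ k, x (k + 1) ∈ Metric.ball (Y s) ρ → w k ∈ W) :
    ∃ u' ∈ U, ∃ w' ∈ W, ∀ z ∈ C, 1 / 2 * ‖Y s' - z‖ ^ 2 - 1 / 2 * ‖Y s - z‖ ^ 2 ≤
      (s' - s) * (L * ρ - inner ℝ (u' + w') (Y s - z)) := by
  have hL := h.drift_bound_nonneg
  have hs' : 0 ≤ s' := hs.trans hss'.le
  have hadd : ∀ r : ℝ, Tendsto (fun j => t j + r) atTop atTop := fun r =>
    tendsto_atTop_add_const_right _ _ ht
  let a : ℕ → ℕ := fun j => timeIndex γ (t j + s)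
  let b : ℕ → ℕ := fun j => timeIndex γ (t j + s')
  have ha : Tendsto a atTop atTop := (tendsto_timeIndex h.pos hdiv).comp (hadd s)
  have hab : ∀ j, a j ≤ b j := fun j =>
    timeIndex_mono h.pos hdiv (add_nonneg (ht0 j) hs) (by linarith)
  have hlim : ∀ r, 0 ≤ r → Tendsto (fun j => x (timeIndex γ (t j + r))) atTop (𝓝 (Y r)) := by
    intro r hr
    have h1 := tendsto_zero_iff_norm_tendsto_zero.2 ((h.tendsto_interpolation_sub hdiv hγ).comp
      (hadd r) : Tendsto (fun j => ‖interpolation γ x (t j + r) - x (timeIndex γ (t j + r))‖)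
        atTop (𝓝 0))
    simpa using (hY r hr).sub h1
  have hsum : Tendsto (fun j => ∑ k ∈ Finset.Ico (a j) (b j), γ k) atTop (𝓝 (s' - s)) := by
    have := (tendsto_sum_Ico_timeIndex h.pos hdiv hγ (s := fun j => t j + s)
      (t := fun j => t j + s') (fun j => add_nonneg (ht0 j) hs) (fun j => by linarith)
      (hadd s)).add_const (s' - s)
    rw [zero_add] at this
    refine this.congr fun j => ?_
    simp only [a, b]
    ring
  -- Three quarters of the slack in `hρ` are spent: on the displacement error, on the window length,
  -- and on the distance from `x (a j)` to `Y s`. The whole window then stays in the ball of radius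
  -- `ρ`.
  have hε : 0 < (ρ - 2 * L * (s' - s)) / 4 := by linarith
  obtain ⟨n₀, hn₀⟩ := h.norm_sub_le (s' - s + 1) hε
  have hev : ∀ᶠ j in atTop, ∃ p ∈ U ×ˢ W, ∀ z ∈ C,
      1 / 2 * ‖x (b j) - z‖ ^ 2 - 1 / 2 * ‖x (a j) - z‖ ^ 2 ≤
      (∑ k ∈ Finset.Ico (a j) (b j), γ k) * (L * ρ - inner ℝ (p.1 + p.2) (Y s - z))
      + (‖N (b j) - N (a j)‖ + ‖M (b j) - M (a j)‖ + ‖Q (b j) - Q (a j)‖) * (1 + ‖z‖) := by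
    filter_upwards [ha.eventually_ge_atTop n₀, hsum.eventually (gt_mem_nhds (lt_add_one _)),
      hsum.eventually (lt_mem_nhds (sub_pos.2 hss')),
      (hsum.const_mul (2 * L)).eventually (gt_mem_nhds (lt_add_of_pos_right _ hε)),
      (hlim s hs).eventually (Metric.ball_mem_nhds _ hε)] with j h1 h2 h3 h4 h5
    have hlt : a j < b j := by
      rcases (hab j).lt_or_eq with hlt | heq
      · exact hlt
      · rw [heq] at h3
        simp at h3
    have hball : ∀ k, a j ≤ k → k ≤ b j → x k ∈ Metric.ball (Y s) ρ := by
      intro k hk1 hk2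
      have hsub : ∑ i ∈ Finset.Ico (a j) k, γ i ≤ ∑ i ∈ Finset.Ico (a j) (b j), γ i :=
        Finset.sum_le_sum_of_subset_of_nonneg (Finset.Ico_subset_Ico_right hk2)
          fun i _ _ => (h.pos i).le
      have h6 := hn₀ (a j) h1 k hk1 (hsub.trans h2.le)
      have h7 := mul_le_mul_of_nonneg_left hsub (show 0 ≤ 2 * L by positivity)
      have h8 := dist_triangle (x k) (x (a j)) (Y s)
      rw [dist_eq_norm (x k) (x (a j))] at h8
      have h9 : dist (x (a j)) (Y s) < _ := h5
      rw [Metric.mem_ball]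
      linarith
    obtain ⟨u', hu', w', hw', hz⟩ := h.exists_average_drift hUc hWc hlt hball hv hw
    exact ⟨(u', w'), ⟨hu', hw'⟩, hz⟩
  obtain ⟨j₀, hj₀⟩ := eventually_atTop.1 hev
  choose p hp hpz using fun j : ℕ => hj₀ (j + j₀) (Nat.le_add_left _ _)
  -- The subsequence is extracted before `z` is fixed, so the limit drifts are common to all `z ∈
  -- C`.
  obtain ⟨q, hq, φ, hφ, hpq⟩ := (hU.prod hW).tendsto_subseq hp
  refine ⟨q.1, hq.1, q.2, hq.2, fun z hz => ?_⟩
  have hψ : Tendsto (fun j => φ j + j₀) atTop atTop :=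
    (tendsto_add_atTop_nat j₀).comp hφ.tendsto_atTop
  have hN := h.vanishes_N.tendsto ha hab hsum
  have hM := h.vanishes_M.tendsto ha hab hsum
  have hQ := h.vanishes_Q.tendsto ha hab hsum
  have hlhs : Tendsto (fun j => 1 / 2 * ‖x (b j) - z‖ ^ 2 - 1 / 2 * ‖x (a j) - z‖ ^ 2) atTop
      (𝓝 (1 / 2 * ‖Y s' - z‖ ^ 2 - 1 / 2 * ‖Y s - z‖ ^ 2)) :=
    ((((hlim s' hs').sub_const z).norm.pow 2).const_mul _).sub
      ((((hlim s hs).sub_const z).norm.pow 2).const_mul _)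
  have hin : Tendsto (fun j => inner ℝ ((p (φ j)).1 + (p (φ j)).2) (Y s - z)) atTop
      (𝓝 (inner ℝ (q.1 + q.2) (Y s - z))) := by
    have hc : Continuous fun r : E × E => inner ℝ (r.1 + r.2) (Y s - z) := by fun_prop
    exact (hc.tendsto q).comp hpq
  have hrhs := ((hsum.comp hψ).mul (hin.const_sub (L * ρ))).add
    ((((hN.add hM).add hQ).mul_const (1 + ‖z‖)).comp hψ)
  simp only [add_zero, zero_mul] at hrhs
  exact le_of_tendsto_of_tendsto' (hlhs.comp hψ) hrhs fun j => hpz (φ j) z hz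

/-- Up to `ε`, the differential inclusion holds for limit curves at points of differentiability. -/
theorem exists_approx_inclusion [FiniteDimensional ℝ E]
    (h : IsApproximatePath C γ x (fun n => v n + w n) M N Q R L)
    (hdiv : Tendsto (fun n => ∑ i ∈ Finset.range n, γ i) atTop atTop)
    (hγ : Tendsto γ atTop (𝓝 0)) {f g : E → ℝ} (hf : LocallyLipschitz f) (hg : LocallyLipschitz g)
    (hv : ∀ n, v n ∈ clarkeSubdifferential f (x n))
    (hw : ∀ n, w n ∈ clarkeSubdifferential g (x (n + 1)))
    {t : ℕ → ℝ} (ht0 : ∀ j, 0 ≤ t j) (ht : Tendsto t atTop atTop)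
    {Y : ℝ → E} (hY : ∀ s, 0 ≤ s → Tendsto (fun j => interpolation γ x (t j + s)) atTop (𝓝 (Y s)))
    {s : ℝ} (hs : 0 ≤ s) {D : E} (hD : HasDerivAt Y D s) {ε : ℝ} (hε : 0 < ε) :
    ∃ u' ∈ clarkeSubdifferential f (Y s), ∃ w' ∈ clarkeSubdifferential g (Y s), ∀ z ∈ C,
      inner ℝ (D + u' + w') (Y s - z) ≤ ε * (1 + ‖Y s - z‖) := by
  have hL := h.drift_bound_nonneg
  have hε3 : 0 < ε / 3 := by positivity
  obtain ⟨δ₁, hδ₁, hfu⟩ := hf.exists_ball_clarkeSubdifferential_subset (Y s) hε3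
  obtain ⟨δ₂, hδ₂, hgu⟩ := hg.exists_ball_clarkeSubdifferential_subset (Y s) hε3
  have hρ0 : 0 < min (min δ₁ δ₂) (ε / (L + 1)) := by positivity
  -- The bound `L * ρ ≤ ε` gives the constant part of the error. The part proportional to `‖Y s -
  -- z‖` is three times `ε / 3`: from the difference quotient and from the two thickenings.
  set ρ := min (min δ₁ δ₂) (ε / (L + 1)) with hρ
  have hLρ : L * ρ ≤ ε := by
    have h1 : ρ ≤ ε / (L + 1) := min_le_right _ _
    rw [le_div_iff₀ (by positivity)] at h1
    nlinarith
  have hcf := hf.isCompact_clarkeSubdifferential (Y s)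
  have hcg := hg.isCompact_clarkeSubdifferential (Y s)
  have hder : ∀ᶠ r in 𝓝[>] (0 : ℝ), ‖Y (s + r) - Y s - r • D‖ ≤ ε / 3 * r := by
    have h1 := (hasDerivAt_iff_isLittleO_nhds_zero.1 hD).def hε3
    filter_upwards [nhdsWithin_le_nhds h1, self_mem_nhdsWithin] with r hr hr0
    rwa [Real.norm_of_nonneg (le_of_lt hr0)] at hr
  have hsmall : ∀ᶠ r in 𝓝[>] (0 : ℝ), 2 * L * r < ρ := by
    have hc : Continuous fun r : ℝ => 2 * L * r := by fun_prop
    have h1 := hc.tendsto 0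
    rw [mul_zero] at h1
    exact nhdsWithin_le_nhds (h1.eventually (gt_mem_nhds hρ0))
  obtain ⟨r, hr1, hr2, hr0⟩ := (hder.and (hsmall.and self_mem_nhdsWithin)).exists
  have hr0 : 0 < r := hr0
  obtain ⟨u₁, hu₁, w₁, hw₁, hz⟩ := h.exists_limit_drift hdiv hγ ht0 ht hY hs
    (lt_add_of_pos_right s hr0) (by rwa [add_sub_cancel_left])
    hcf.cthickening ((convex_clarkeSubdifferential f _).cthickening _)
    hcg.cthickening ((convex_clarkeSubdifferential g _).cthickening _)
    (fun k hk => hfu _ (Metric.ball_subset_ball ((min_le_left _ _).trans (min_le_left _ _)) hk)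
      (hv k))
    (fun k hk => hgu _ (Metric.ball_subset_ball ((min_le_left _ _).trans (min_le_right _ _)) hk)
      (hw k))
  rw [hcf.cthickening_eq_biUnion_closedBall hε3.le] at hu₁
  rw [hcg.cthickening_eq_biUnion_closedBall hε3.le] at hw₁
  simp only [Set.mem_iUnion, mem_closedBall_iff_norm, exists_prop] at hu₁ hw₁
  obtain ⟨u', hu', hun⟩ := hu₁
  obtain ⟨w', hw', hwn⟩ := hw₁
  refine ⟨u', hu', w', hw', fun z hzC => ?_⟩
  have h1 := hz z hzC
  rw [add_sub_cancel_left] at h1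
  have h2 : 1 / 2 * ‖Y (s + r) - z‖ ^ 2 - 1 / 2 * ‖Y s - z‖ ^ 2 ≥
      inner ℝ (Y (s + r) - Y s) (Y s - z) := by
    have : ‖Y (s + r) - z‖ ^ 2 = ‖Y (s + r) - Y s‖ ^ 2
        + 2 * inner ℝ (Y (s + r) - Y s) (Y s - z) + ‖Y s - z‖ ^ 2 := by
      rw [show Y (s + r) - z = (Y (s + r) - Y s) + (Y s - z) by abel, norm_add_sq_real]
    nlinarith [sq_nonneg ‖Y (s + r) - Y s‖]
  have hinner : ∀ e : E, ∀ κ : ℝ, ‖e‖ ≤ κ → -inner ℝ e (Y s - z) ≤ κ * ‖Y s - z‖ :=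
    fun e κ he => (neg_le_abs _).trans ((abs_real_inner_le_norm _ _).trans
      (mul_le_mul_of_nonneg_right he (norm_nonneg _)))
  have h3 := hinner _ _ hr1
  have h4 := hinner _ _ hun
  have h5 := hinner _ _ hwn
  rw [inner_sub_left, real_inner_smul_left] at h3
  rw [inner_sub_left] at h4 h5
  rw [inner_add_left] at h1
  rw [inner_add_left, inner_add_left]
  have h6 : r * inner ℝ D (Y s - z) ≤
      r * (ε - (inner ℝ u₁ (Y s - z) + inner ℝ w₁ (Y s - z)) + ε / 3 * ‖Y s - z‖) := by
    have := mul_le_mul_of_nonneg_left hLρ hr0.le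
    linarith
  have h7 := le_of_mul_le_mul_left h6 hr0
  linarith

/-- Compactness of both subdifferentials lets `ε → 0` in the approximate inclusion. The normal
vector appears only now, as the remainder `-(D + u + w)`. -/
theorem exists_inclusion [FiniteDimensional ℝ E]
    (h : IsApproximatePath C γ x (fun n => v n + w n) M N Q R L)
    (hdiv : Tendsto (fun n => ∑ i ∈ Finset.range n, γ i) atTop atTop)
    (hγ : Tendsto γ atTop (𝓝 0)) {f g : E → ℝ} (hf : LocallyLipschitz f) (hg : LocallyLipschitz g)
    (hv : ∀ n, v n ∈ clarkeSubdifferential f (x n))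
    (hw : ∀ n, w n ∈ clarkeSubdifferential g (x (n + 1)))
    {t : ℕ → ℝ} (ht0 : ∀ j, 0 ≤ t j) (ht : Tendsto t atTop atTop)
    {Y : ℝ → E} (hY : ∀ s, 0 ≤ s → Tendsto (fun j => interpolation γ x (t j + s)) atTop (𝓝 (Y s)))
    {s : ℝ} (hs : 0 ≤ s) {D : E} (hD : HasDerivAt Y D s) : D ∈ drift f g C (Y s) := by
  choose u hu w' hw' hz using fun i : ℕ => h.exists_approx_inclusion hdiv hγ hf hg hv hw ht0 ht hY
    hs hD (show 0 < 1 / ((i : ℝ) + 1) by positivity)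
  obtain ⟨q, hq, φ, hφ, hpq⟩ := ((hf.isCompact_clarkeSubdifferential (Y s)).prod
    (hg.isCompact_clarkeSubdifferential (Y s))).tendsto_subseq
    (x := fun i => (u i, w' i)) (fun i => ⟨hu i, hw' i⟩)
  have hmem : -(D + q.1 + q.2) ∈ normalCone C (Y s) := by
    intro z hzC
    have hc : Continuous fun r : E × E => inner ℝ (D + r.1 + r.2) (Y s - z) := by fun_prop
    have hl := (hc.tendsto q).comp hpq
    have hr : Tendsto (fun i : ℕ => 1 / ((i : ℝ) + 1) * (1 + ‖Y s - z‖)) atTop (𝓝 0) := by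
      simpa using tendsto_one_div_add_atTop_nhds_zero_nat.mul_const (1 + ‖Y s - z‖)
    have := le_of_tendsto_of_tendsto' hl (hr.comp hφ.tendsto_atTop) fun i => hz (φ i) z hzC
    rwa [inner_neg_left, ← inner_neg_right, neg_sub]
  refine ⟨-q.1 - q.2, ⟨-q.1, by simpa using hq.1, q.2, hq.2, rfl⟩, _, hmem, ?_⟩
  simp only
  abel

/-- Limit curves are `2 L`-Lipschitz, hence absolutely continuous and differentiable almost
everywhere; the inclusion holds at every positive differentiability point. -/
theorem isSolution_of_tendsto [FiniteDimensional ℝ E]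
    (h : IsApproximatePath C γ x (fun n => v n + w n) M N Q R L) (hpos : ∀ n, 0 < γ n)
    (hdiv : Tendsto (fun n => ∑ i ∈ Finset.range n, γ i) atTop atTop)
    (hγ : Tendsto γ atTop (𝓝 0)) {f g : E → ℝ} (hf : LocallyLipschitz f) (hg : LocallyLipschitz g)
    (hv : ∀ n, v n ∈ clarkeSubdifferential f (x n))
    (hw : ∀ n, w n ∈ clarkeSubdifferential g (x (n + 1)))
    {t : ℕ → ℝ≥0} (ht : Tendsto t atTop atTop) {y : C(ℝ≥0, E)}
    (hy : Tendsto (fun n => shift (interpolatedProcess γ hpos hdiv x) (t n)) atTop (𝓝 y)) :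
    IsSolution (drift f g C) y := by
  have ht' : Tendsto (fun j => (t j : ℝ)) atTop atTop := NNReal.tendsto_coe_atTop.2 ht
  have hY : ∀ s : ℝ, 0 ≤ s → Tendsto (fun j => interpolation γ x ((t j : ℝ) + s)) atTop
      (𝓝 (y s.toNNReal)) := by
    intro s hs
    have h1 := ((ContinuousEvalConst.continuous_eval_const s.toNNReal).tendsto y).comp hy
    refine h1.congr fun j => ?_
    simp [shift, interpolatedProcess, hs]
  have hL : 0 ≤ 2 * L := mul_nonneg two_pos.le h.drift_bound_nonneg
  have hlip : LipschitzWith (2 * L).toNNReal (fun s : ℝ => y s.toNNReal) := by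
    have hy1 : LipschitzWith (2 * L).toNNReal y := by
      refine LipschitzWith.of_dist_le_mul fun a b => ?_
      rw [Real.coe_toNNReal _ hL]
      have key : ∀ a b : ℝ≥0, a ≤ b → dist (y a) (y b) ≤ 2 * L * dist a b := by
        intro a b hab
        have hab' : (a : ℝ) ≤ b := by exact_mod_cast hab
        have := h.norm_limit_sub_le hdiv hγ ht' hY a.coe_nonneg hab'
        simp only [Real.toNNReal_coe] at this
        rwa [dist_comm, dist_eq_norm, dist_comm, NNReal.dist_eq,
          abs_of_nonneg (sub_nonneg.2 hab')]
      rcases le_total a b with hab | hab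
      · exact key a b hab
      · rw [dist_comm, dist_comm a]
        exact key b a hab
    have hy2 : LipschitzWith 1 Real.toNNReal := by
      refine LipschitzWith.of_dist_le_mul fun a b => ?_
      rw [NNReal.coe_one, one_mul, NNReal.dist_eq, Real.dist_eq]
      simpa using abs_max_sub_max_le_abs a b 0
    simpa [Function.comp_def] using hy1.comp hy2
  refine ⟨fun T _ => hlip.lipschitzOnWith.absolutelyContinuousOnInterval, ?_⟩
  rw [ae_restrict_iff' measurableSet_Ioi]
  filter_upwards [hlip.ae_differentiableAt] with s hs hs0
  exact ⟨_, h.exists_inclusion hdiv hγ hf hg hv hw (fun j => (t j).2) ht' hY (le_of_lt hs0)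
    hs.hasDerivAt, hs.hasDerivAt⟩

end IsApproximatePath

/-! ### Expansions of `|·| ^ q` -/

section PowerInequalities

/-- The tangent line inequality at `y` for a convex power, read off from Bernoulli's inequality. -/
theorem rpow_sub_rpow_le {p x y : ℝ} (hp : 1 ≤ p) (hx : 0 ≤ x) (hy : 0 < y) :
    y ^ p - x ^ p ≤ p * y ^ (p - 1) * (y - x) := by
  have h := one_add_mul_self_le_rpow_one_add (s := (x - y) / y) (p := p)
    (by rw [le_div_iff₀ hy]; linarith) hp
  rw [show 1 + (x - y) / y = x / y by field_simp; ring, Real.div_rpow hx hy.le,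
    le_div_iff₀ (Real.rpow_pos_of_pos hy p)] at h
  have hyp : y ^ p = y ^ (p - 1) * y := by
    rw [← Real.rpow_add_one hy.ne', sub_add_cancel]
  have h2 : (1 + p * ((x - y) / y)) * y ^ p = y ^ p - p * y ^ (p - 1) * (y - x) := by
    rw [hyp]; field_simp; ring
  linarith

/-- The tangent inequality is used for the exponent `q`, and again for `q - 1` to compare slopes at
`a` and `a + b`. The condition on `b` keeps `a + b` in `(0, 2 a)`, whence the power of `2`. -/
theorem rpow_add_le_of_abs_lt {q a b : ℝ} (hq : 2 ≤ q) (ha : 0 < a) (hb : |b| < a) :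
    (a + b) ^ q ≤ a ^ q + q * a ^ (q - 1) * b
      + q * (q - 1) * 2 ^ (q - 2) * (a ^ (q - 2) * b ^ 2) := by
  obtain ⟨hb1, hb2⟩ := abs_lt.1 hb
  have hab : 0 < a + b := by linarith
  have h1 := rpow_sub_rpow_le (p := q) (by linarith) ha.le hab
  rw [add_sub_cancel_left] at h1
  have hpow : (2 * a) ^ (q - 2) = 2 ^ (q - 2) * a ^ (q - 2) := Real.mul_rpow two_pos.le ha.le
  have hq1 : q - 1 - 1 = q - 2 := by ring
  have h2 : b * ((a + b) ^ (q - 1) - a ^ (q - 1))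
      ≤ (q - 1) * (2 ^ (q - 2) * a ^ (q - 2)) * b ^ 2 := by
    rcases le_total 0 b with h | h
    · have h3 := rpow_sub_rpow_le (p := q - 1) (by linarith) ha.le hab
      rw [add_sub_cancel_left, hq1] at h3
      have h4 : (a + b) ^ (q - 2) ≤ (2 * a) ^ (q - 2) :=
        Real.rpow_le_rpow hab.le (by linarith) (by linarith)
      rw [hpow] at h4
      calc b * ((a + b) ^ (q - 1) - a ^ (q - 1)) ≤ b * ((q - 1) * (a + b) ^ (q - 2) * b) :=
            mul_le_mul_of_nonneg_left h3 h
        _ = (q - 1) * (a + b) ^ (q - 2) * b ^ 2 := by ring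
        _ ≤ _ := by
          refine mul_le_mul_of_nonneg_right ?_ (sq_nonneg b)
          exact mul_le_mul_of_nonneg_left h4 (by linarith)
    · have h3 := rpow_sub_rpow_le (p := q - 1) (by linarith) hab.le ha
      rw [sub_add_cancel_left, hq1] at h3
      have h4 : a ^ (q - 2) ≤ (2 * a) ^ (q - 2) :=
        Real.rpow_le_rpow ha.le (by linarith) (by linarith)
      rw [hpow] at h4
      calc b * ((a + b) ^ (q - 1) - a ^ (q - 1)) = -b * (a ^ (q - 1) - (a + b) ^ (q - 1)) := by ring
        _ ≤ -b * ((q - 1) * a ^ (q - 2) * -b) := mul_le_mul_of_nonneg_left h3 (by linarith)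
        _ = (q - 1) * a ^ (q - 2) * b ^ 2 := by ring
        _ ≤ _ := by
          refine mul_le_mul_of_nonneg_right ?_ (sq_nonneg b)
          exact mul_le_mul_of_nonneg_left h4 (by linarith)
  have h5 := mul_le_mul_of_nonneg_left h2 (show 0 ≤ q by linarith)
  linarith

/-- Second order expansion of `|·| ^ q` for `q ≥ 2`. -/
theorem abs_add_rpow_le {q : ℝ} (hq : 2 ≤ q) : ∃ K : ℝ, 0 < K ∧ ∀ a b : ℝ,
    |a + b| ^ q ≤ |a| ^ q + q * (|a| ^ (q - 2) * a) * b
      + K * (|a| ^ (q - 2) * b ^ 2 + |b| ^ q) := by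
  have hq0 : 0 < q := by linarith
  have hq1 : 0 ≤ q - 1 := by linarith
  refine ⟨q * (q - 1) * 2 ^ (q - 2) + 2 ^ q + q, by positivity, fun a b => ?_⟩
  have e1 : 0 ≤ |a| ^ (q - 2) * b ^ 2 := by positivity
  have e2 : 0 ≤ |b| ^ q := by positivity
  have e3 : 0 ≤ q * (q - 1) * 2 ^ (q - 2) := by positivity
  have e4 : (0 : ℝ) ≤ 2 ^ q := by positivity
  -- A Taylor-type bound is available only for `|b| < |a|`; otherwise `|b| ^ q` dominates every
  -- term.
  rcases lt_or_ge |b| |a| with hlt | hge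
  · have key : |a + b| ^ q ≤ |a| ^ q + q * (|a| ^ (q - 2) * a) * b
        + q * (q - 1) * 2 ^ (q - 2) * (|a| ^ (q - 2) * b ^ 2) := by
      have ha : 0 < |a| := (abs_nonneg b).trans_lt hlt
      have hpow : |a| ^ (q - 1) = |a| ^ (q - 2) * |a| := by
        rw [← Real.rpow_add_one ha.ne']; congr 1; ring
      rcases le_total 0 a with h | h
      · rw [abs_of_nonneg h] at ha hpow hlt ⊢
        have := rpow_add_le_of_abs_lt hq ha hlt
        rw [abs_of_nonneg (by linarith [(abs_lt.1 hlt).1])]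
        rw [hpow] at this
        linarith
      · rw [abs_of_nonpos h] at ha hpow hlt ⊢
        have := rpow_add_le_of_abs_lt (b := -b) hq ha (by rwa [abs_neg])
        rw [abs_of_nonpos (by linarith [(abs_lt.1 hlt).2]), neg_add]
        rw [hpow, neg_sq] at this
        linarith
    nlinarith [mul_nonneg e4 e1, mul_nonneg e4 e2, mul_nonneg hq0.le e1, mul_nonneg hq0.le e2,
      mul_nonneg e3 e2]
  · have h1 : |a + b| ^ q ≤ 2 ^ q * |b| ^ q := by
      rw [← Real.mul_rpow two_pos.le (abs_nonneg b)]
      exact Real.rpow_le_rpow (abs_nonneg _) (by linarith [abs_add_le a b]) hq0.le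
    have h2 : -(q * (|a| ^ (q - 2) * a) * b) ≤ q * |b| ^ q := by
      have h3 : |a| ^ (q - 2) ≤ |b| ^ (q - 2) :=
        Real.rpow_le_rpow (abs_nonneg _) hge (by linarith)
      have h4 : |b| ^ q = |b| ^ (q - 2) * (|b| * |b|) := by
        rw [← sq, ← Real.rpow_natCast, ← Real.rpow_add_of_nonneg (abs_nonneg b) (by linarith)
          (by norm_num)]
        congr 1; push_cast; ring
      have h5 : -(a * b) ≤ |b| * |b| := by
        refine (neg_le_abs _).trans ?_
        rw [abs_mul]
        exact mul_le_mul_of_nonneg_right hge (abs_nonneg b)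
      rw [h4]
      calc -(q * (|a| ^ (q - 2) * a) * b) = q * (|a| ^ (q - 2) * -(a * b)) := by ring
        _ ≤ q * (|a| ^ (q - 2) * (|b| * |b|)) := by gcongr
        _ ≤ _ := by gcongr
    have e5 : 0 ≤ |a| ^ q := by positivity
    nlinarith [mul_nonneg e4 e1, mul_nonneg hq0.le e1, mul_nonneg e3 e1, mul_nonneg e3 e2]

/-- A form of Young's inequality. -/
theorem mul_rpow_mul_le {q : ℝ} (hq : 2 ≤ q) {K : ℝ} (hK : 0 < K) {a s : ℝ} (ha : 0 ≤ a)
    (hs : 0 ≤ s) :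
    K * (a ^ (q - 2) * s) ≤ 1 / 2 * a ^ q + K * (2 * K) ^ (q / 2 - 1) * s ^ (q / 2) := by
  have e0 : 0 ≤ a ^ (q - 2) := by positivity
  rcases le_total (2 * K * s) (a ^ 2) with h | h
  · have h1 : a ^ q = a ^ (q - 2) * a ^ 2 := by
      rw [← Real.rpow_natCast, ← Real.rpow_add_of_nonneg ha (by linarith) (by norm_num)]
      congr 1; push_cast; ring
    have h2 : 0 ≤ K * (2 * K) ^ (q / 2 - 1) * s ^ (q / 2) := by positivity
    have h3 := mul_le_mul_of_nonneg_left h e0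
    rw [h1]
    linarith
  · have h1 : a ^ (q - 2) = (a ^ 2) ^ (q / 2 - 1) := by
      rw [← Real.rpow_natCast, ← Real.rpow_mul ha]
      congr 1; push_cast; ring
    have h2 : (a ^ 2) ^ (q / 2 - 1) ≤ (2 * K) ^ (q / 2 - 1) * s ^ (q / 2 - 1) := by
      rw [← Real.mul_rpow (by positivity) hs]
      exact Real.rpow_le_rpow (by positivity) h (by linarith)
    have h3 : s ^ (q / 2) = s ^ (q / 2 - 1) * s := by
      conv_rhs => rw [← Real.rpow_one s]
      rw [← Real.rpow_mul hs, one_mul, ← Real.rpow_add_of_nonneg hs (by linarith) zero_le_one,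
        sub_add_cancel]
    have h4 : 0 ≤ a ^ q := by positivity
    rw [h1, h3]
    have h5 := mul_le_mul_of_nonneg_left (mul_le_mul_of_nonneg_right h2 hs) hK.le
    linarith

/-- Expansion of `|a + γ ζ| ^ q` adapted to step sizes `γ ≤ Γ`. -/
theorem abs_add_mul_rpow_le {q : ℝ} (hq : 2 ≤ q) {Γ : ℝ} (hΓ : 0 ≤ Γ) : ∃ K : ℝ, 0 ≤ K ∧
    ∀ γ a ζ : ℝ, 0 < γ → γ ≤ Γ → |a + γ * ζ| ^ q ≤ (1 + γ / 2) * |a| ^ q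
      + γ * q * (|a| ^ (q - 2) * a) * ζ + K * (γ ^ (1 + q / 2) * |ζ| ^ q) := by
  obtain ⟨K, hK, h⟩ := abs_add_rpow_le hq
  refine ⟨K * (2 * K) ^ (q / 2 - 1) + K * Γ ^ (q / 2 - 1), by positivity, fun γ a ζ hγ hγΓ => ?_⟩
  have h1 := h a (γ * ζ)
  -- Young's inequality is applied with `s = γ ζ ^ 2`, keeping the other factor `γ` outside. This
  -- produces both the small growth rate `γ / 2` and the exponent `1 + q / 2` of the step size
  -- condition.
  have h2 := mul_le_mul_of_nonneg_left (mul_rpow_mul_le hq hK (abs_nonneg a)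
    (show 0 ≤ γ * |ζ| ^ 2 by positivity)) hγ.le
  have h3 : (γ * |ζ| ^ 2) ^ (q / 2) = γ ^ (q / 2) * |ζ| ^ q := by
    rw [Real.mul_rpow hγ.le (by positivity), ← Real.rpow_natCast, ← Real.rpow_mul (abs_nonneg ζ)]
    congr 2; push_cast; ring
  have h4 : γ ^ (1 + q / 2) = γ * γ ^ (q / 2) := by
    rw [Real.rpow_add hγ, Real.rpow_one]
  have h5 : |γ * ζ| ^ q ≤ Γ ^ (q / 2 - 1) * (γ ^ (1 + q / 2) * |ζ| ^ q) := by
    rw [abs_mul, abs_of_pos hγ, Real.mul_rpow hγ.le (abs_nonneg ζ), ← mul_assoc]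
    refine mul_le_mul_of_nonneg_right ?_ (by positivity)
    rw [show γ ^ q = γ ^ (q / 2 - 1) * γ ^ (1 + q / 2) by
      rw [← Real.rpow_add hγ]; congr 1; ring]
    exact mul_le_mul_of_nonneg_right (Real.rpow_le_rpow hγ.le hγΓ (by linarith)) (by positivity)
  have h6 := mul_le_mul_of_nonneg_left h5 hK.le
  rw [h3] at h2
  have h7 : K * (|a| ^ (q - 2) * (γ * ζ) ^ 2) = γ * (K * (|a| ^ (q - 2) * (γ * |ζ| ^ 2))) := by
    rw [sq_abs]; ring
  rw [mul_add, h7] at h1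
  rw [h4] at h6 ⊢
  linarith

end PowerInequalities

/-! ### A Robbins–Siegmund theorem -/

section AlmostSupermartingale

variable {Ω : Type*} {m0 : MeasurableSpace Ω} {P : Measure Ω}

theorem ae_summable_of_summable_integral {r : ℕ → Ω → ℝ} (hr0 : ∀ n ω, 0 ≤ r n ω)
    (hri : ∀ n, Integrable (r n) P) (hrs : Summable fun n => ∫ ω, r n ω ∂P) :
    ∀ᵐ ω ∂P, Summable fun n => r n ω := by
  have h1 : ∫⁻ ω, ∑' n, ENNReal.ofReal (r n ω) ∂P ≠ ∞ := by
    rw [lintegral_tsum fun n => (hri n).aemeasurable.ennreal_ofReal]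
    simp_rw [← ofReal_integral_eq_lintegral_ofReal (hri _) (Eventually.of_forall (hr0 _))]
    exact hrs.tsum_ofReal_ne_top
  filter_upwards [ae_lt_top' (AEMeasurable.tsum
    fun n => (hri n).aemeasurable.ennreal_ofReal) h1] with ω hω
  simpa [ENNReal.toReal_ofReal (hr0 _ ω)] using ENNReal.summable_toReal hω.ne

theorem condExp_integral_eq_zero [IsFiniteMeasure P] {m : MeasurableSpace Ω} (hm : m ≤ m0)
    {d : Ω → ℝ} (hd : P[d | m] =ᵐ[P] 0) : ∫ ω, d ω ∂P = 0 := by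
  rw [← integral_condExp hm, integral_congr_ae hd]
  simp

/-- A Robbins–Siegmund type result: nonnegative sequences that contract in conditional mean with
non-summable rates, up to perturbations with summable means, converge to zero. -/
theorem ae_tendsto_zero_of_le_contraction [IsProbabilityMeasure P] {ℱ : Filtration ℕ m0}
    {U d r : ℕ → Ω → ℝ} {c : ℕ → ℝ} (hU0 : ∀ n ω, 0 ≤ U n ω) (hUad : StronglyAdapted ℱ U)
    (hUi : ∀ n, Integrable (U n) P) (hdi : ∀ n, Integrable (d n) P)
    (hd : ∀ n, P[d n | ℱ n] =ᵐ[P] 0) (hr0 : ∀ n ω, 0 ≤ r n ω)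
    (hrm : ∀ n, StronglyMeasurable[ℱ (n + 1)] (r n)) (hri : ∀ n, Integrable (r n) P)
    (hrs : Summable fun n => ∫ ω, r n ω ∂P) (hc0 : ∀ n, 0 ≤ c n)
    (hc : Tendsto (fun n => ∑ k ∈ Finset.range n, c k) atTop atTop)
    (hstep : ∀ n ω, U (n + 1) ω ≤ (1 - c n) * U n ω + d n ω + r n ω) :
    ∀ᵐ ω ∂P, Tendsto (fun n => U n ω) atTop (𝓝 0) := by
  have hEU0 : ∀ n, 0 ≤ ∫ ω, U n ω ∂P := fun n => integral_nonneg (hU0 n)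
  have hEr0 : ∀ n, 0 ≤ ∫ ω, r n ω ∂P := fun n => integral_nonneg (hr0 n)
  have hmean : ∀ n, ∫ ω, U (n + 1) ω ∂P + c n * ∫ ω, U n ω ∂P
      ≤ ∫ ω, U n ω ∂P + ∫ ω, r n ω ∂P := by
    intro n
    have hUd : Integrable (fun ω => (1 - c n) * U n ω + d n ω) P :=
      ((hUi n).const_mul _).add (hdi n)
    have h1 : ∫ ω, U (n + 1) ω ∂P ≤ ∫ ω, ((1 - c n) * U n ω + d n ω + r n ω) ∂P :=
      integral_mono (hUi _) (hUd.add (hri n)) (hstep n)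
    rw [integral_add hUd (hri n),
      integral_add ((hUi n).const_mul _) (hdi n), integral_const_mul,
      condExp_integral_eq_zero (ℱ.le n) (hd n)] at h1
    linarith
  have hsum : ∀ n, ∫ ω, U n ω ∂P + ∑ k ∈ Finset.range n, c k * ∫ ω, U k ω ∂P
      ≤ ∫ ω, U 0 ω ∂P + ∑ k ∈ Finset.range n, ∫ ω, r k ω ∂P := by
    intro n
    induction n with
    | zero => simp
    | succ n ih =>
      rw [Finset.sum_range_succ, Finset.sum_range_succ]
      linarith [hmean n]
  set B := ∫ ω, U 0 ω ∂P + ∑' k, ∫ ω, r k ω ∂P with hB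
  have hbound : ∀ n, ∫ ω, U n ω ∂P + ∑ k ∈ Finset.range n, c k * ∫ ω, U k ω ∂P ≤ B := fun n =>
    (hsum n).trans (add_le_add le_rfl (hrs.sum_le_tsum _ fun k _ => hEr0 k))
  have hcU : Summable fun k => ∫ ω, c k * U k ω ∂P := by
    refine summable_of_sum_range_le (c := B)
      (fun k => integral_nonneg fun ω => mul_nonneg (hc0 k) (hU0 k ω)) fun n => ?_
    simp_rw [integral_const_mul]
    linarith [hbound n, hEU0 n]
  -- Compensating the contraction and the perturbation makes `W` a supermartingale bounded in `L¹`.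
  -- It converges, and so do both compensating series, hence so does `U`; a positive limit would
  -- contradict the divergence of `∑ c`.
  let W : ℕ → Ω → ℝ := fun n ω => U n ω + ∑ k ∈ Finset.range n, (c k * U k ω - r k ω)
  have hSad : StronglyAdapted ℱ fun n ω => ∑ k ∈ Finset.range n, (c k * U k ω - r k ω) := by
    intro n
    refine Finset.stronglyMeasurable_fun_sum _ fun k hk => ?_
    rw [Finset.mem_range] at hk
    exact (((hUad k).mono (ℱ.mono hk.le)).const_mul _).sub ((hrm k).mono (ℱ.mono hk))
  have hWad : StronglyAdapted ℱ W := fun n => (hUad n).add (hSad n)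
  have hSi : ∀ n, Integrable (fun ω => ∑ k ∈ Finset.range n, (c k * U k ω - r k ω)) P := fun n =>
    integrable_finsetSum _ fun k _ => ((hUi k).const_mul _).sub (hri k)
  have hWi : ∀ n, Integrable (W n) P := fun n => (hUi n).add (hSi n)
  have hWstep : ∀ n, P[W (n + 1) | ℱ n] ≤ᵐ[P] W n := by
    intro n
    have h1 : W (n + 1) ≤ᵐ[P] W n + d n := by
      refine Eventually.of_forall fun ω => ?_
      simp only [W, Pi.add_apply, Finset.sum_range_succ]
      linarith [hstep n ω]
    have h2 := condExp_mono (m := ℱ n) (hWi (n + 1)) ((hWi n).add (hdi n)) h1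
    have h3 := condExp_add (hWi n) (hdi n) (ℱ n)
    rw [condExp_of_stronglyMeasurable (ℱ.le n) (hWad n) (hWi n)] at h3
    filter_upwards [h2, h3, hd n] with ω h2 h3 h4
    rw [h3, Pi.add_apply, h4] at h2
    simpa using h2
  have hsub : Submartingale (-W) ℱ P := (supermartingale_nat hWad hWi hWstep).neg
  have hbdd : ∀ n, eLpNorm ((-W) n) 1 P
      ≤ ((B + ∑' k, ∫ ω, r k ω ∂P).toNNReal : ℝ≥0) := by
    intro n
    have hle : ∀ ω, ‖(-W) n ω‖ ≤ U n ω + ∑ k ∈ Finset.range n, (c k * U k ω + r k ω) := by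
      intro ω
      rw [Pi.neg_apply, Pi.neg_apply, norm_neg]
      refine (norm_add_le _ _).trans (add_le_add (Real.norm_of_nonneg (hU0 n ω)).le ?_)
      refine (norm_sum_le _ _).trans (Finset.sum_le_sum fun k _ => ?_)
      refine (norm_sub_le _ _).trans (le_of_eq ?_)
      rw [Real.norm_of_nonneg (hr0 k ω), Real.norm_of_nonneg (mul_nonneg (hc0 k) (hU0 k ω))]
    have hki : ∀ k, Integrable (fun ω => c k * U k ω + r k ω) P := fun k =>
      ((hUi k).const_mul _).add (hri k)
    have hint : Integrable
        (fun ω => U n ω + ∑ k ∈ Finset.range n, (c k * U k ω + r k ω)) P :=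
      (hUi n).add (integrable_finsetSum _ fun k _ => hki k)
    have hWn : Integrable ((-W) n) P := (hWi n).neg
    rw [eLpNorm_one_eq_lintegral_enorm, ← ofReal_integral_norm_eq_lintegral_enorm hWn]
    refine ENNReal.ofReal_le_ofReal ((integral_mono hWn.norm hint hle).trans ?_)
    rw [integral_add (hUi n) (integrable_finsetSum _ fun k _ => hki k),
      integral_finsetSum _ fun k _ => hki k]
    simp_rw [integral_add ((hUi _).const_mul _) (hri _), integral_const_mul]
    rw [Finset.sum_add_distrib]
    linarith [hbound n, hrs.sum_le_tsum (Finset.range n) fun k _ => hEr0 k]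
  filter_upwards [hsub.exists_ae_tendsto_of_bdd hbdd, ae_summable_of_summable_integral hr0 hri hrs,
    ae_summable_of_summable_integral (fun k ω => mul_nonneg (hc0 k) (hU0 k ω))
      (fun k => (hUi k).const_mul _) hcU] with ω ⟨c', h1⟩ h2 h3
  have h4 := h1.neg.sub ((h3.sub h2).hasSum.tendsto_sum_nat)
  have h5 : Tendsto (fun n => U n ω) atTop (𝓝 (-c' - ∑' k, (c k * U k ω - r k ω))) := by
    refine h4.congr fun n => ?_
    simp [W]
  set l := -c' - ∑' k, (c k * U k ω - r k ω)
  have hl0 : 0 ≤ l := ge_of_tendsto' h5 fun n => hU0 n ω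
  rcases hl0.eq_or_lt with hl | hl
  · rwa [hl]
  · exfalso
    obtain ⟨n₀, hn₀⟩ := eventually_atTop.1 (h5.eventually (lt_mem_nhds (half_lt_self hl)))
    have hcs : Summable fun k => c (k + n₀) := by
      have h6 := ((summable_nat_add_iff n₀).2 h3).mul_left (l / 2)⁻¹
      refine Summable.of_nonneg_of_le (fun k => hc0 _) (fun k => ?_) h6
      have h7 := mul_le_mul_of_nonneg_left (hn₀ (k + n₀) (Nat.le_add_left _ _)).le (hc0 (k + n₀))
      rw [inv_mul_eq_div, le_div_iff₀ (half_pos hl)]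
      exact h7
    exact not_tendsto_nhds_of_tendsto_atTop hc _
      ((summable_nat_add_iff n₀).1 hcs).hasSum.tendsto_sum_nat

end AlmostSupermartingale

/-! ### From averages to window sums -/

section Averages

/-- The recursion `Z (n + 1) = (Z n + γ n ζ n) / (1 + γ n)` started at zero. -/
noncomputable def weightedAverage (γ ζ : ℕ → ℝ) : ℕ → ℝ
  | 0 => 0
  | n + 1 => (weightedAverage γ ζ n + γ n * ζ n) / (1 + γ n)

/-- Solving the recursion for the noise gives `γ k ζ k = Z (k + 1) - Z k + γ k Z (k + 1)`. A window
sum is thus a difference of two small terms plus at most `|T|` times a small one, which explains `ε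
/ (2 + |T|)`. -/
theorem vanishesOnWindows_of_weightedAverage {γ ζ : ℕ → ℝ} (hγ : ∀ n, 0 < γ n)
    (h : Tendsto (weightedAverage γ ζ) atTop (𝓝 0)) :
    VanishesOnWindows γ fun n => ∑ k ∈ Finset.range n, γ k * ζ k := by
  intro T ε hε
  have hε' : 0 < ε / (2 + |T|) := by positivity
  obtain ⟨n₀, hn₀⟩ := Metric.tendsto_atTop.1 h _ hε'
  have hZ : ∀ n ≥ n₀, |weightedAverage γ ζ n| ≤ ε / (2 + |T|) := fun n hn => by
    simpa using (hn₀ n hn).le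
  refine ⟨n₀, fun n hn m hm hT => ?_⟩
  have hstep : ∀ k, γ k * ζ k = weightedAverage γ ζ (k + 1) - weightedAverage γ ζ k
      + γ k * weightedAverage γ ζ (k + 1) := fun k => by
    have := hγ k
    rw [weightedAverage]
    field_simp
    ring
  have hsum : ∑ k ∈ Finset.range m, γ k * ζ k - ∑ k ∈ Finset.range n, γ k * ζ k
      = (weightedAverage γ ζ m - weightedAverage γ ζ n)
        + ∑ k ∈ Finset.Ico n m, γ k * weightedAverage γ ζ (k + 1) := by
    rw [← Finset.sum_Ico_eq_sub _ hm, Finset.sum_congr rfl fun k _ => hstep k,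
      Finset.sum_add_distrib, Finset.sum_Ico_sub _ hm]
  have hrem : |∑ k ∈ Finset.Ico n m, γ k * weightedAverage γ ζ (k + 1)|
      ≤ |T| * (ε / (2 + |T|)) := by
    refine (Finset.abs_sum_le_sum_abs _ _).trans ?_
    calc ∑ k ∈ Finset.Ico n m, |γ k * weightedAverage γ ζ (k + 1)|
        ≤ ∑ k ∈ Finset.Ico n m, γ k * (ε / (2 + |T|)) := by
          refine Finset.sum_le_sum fun k hk => ?_
          rw [Finset.mem_Ico] at hk
          rw [abs_mul, abs_of_pos (hγ k)]
          exact mul_le_mul_of_nonneg_left (hZ _ (by omega)) (hγ k).le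
      _ ≤ _ := by
          rw [← Finset.sum_mul]
          exact mul_le_mul_of_nonneg_right (hT.trans (le_abs_self T)) hε'.le
  have h1 : 2 * (ε / (2 + |T|)) + |T| * (ε / (2 + |T|)) = ε := by field_simp
  rw [hsum, Real.norm_eq_abs]
  have h2 := abs_add_le (weightedAverage γ ζ m - weightedAverage γ ζ n)
    (∑ k ∈ Finset.Ico n m, γ k * weightedAverage γ ζ (k + 1))
  have h3 := abs_sub (weightedAverage γ ζ m) (weightedAverage γ ζ n)
  linarith [hZ m (hn.trans hm), hZ n hn]

/-- A weighted sum of squares vanishes on windows if suitable higher powers are summable. -/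
theorem vanishesOnWindows_sum_sq {γ a : ℕ → ℝ} (hγ : ∀ n, 0 < γ n) (ha : ∀ n, 0 ≤ a n) {q : ℝ}
    (hq : 2 ≤ q) (h : Summable fun n => γ n ^ (1 + q / 2) * a n ^ q) :
    VanishesOnWindows γ fun n => ∑ k ∈ Finset.range n, γ k ^ 2 * a k ^ 2 := by
  intro T ε hε
  have hδ : 0 < ε / (2 * (1 + |T|)) := by positivity
  set δ := ε / (2 * (1 + |T|)) with hδdef
  -- Splitting according to whether `γ a ^ 2` is below `δ`: the first term sums to at most `δ T` on
  -- a window, the second is a tail of a convergent series. Summability of `γ ^ 2 * a ^ 2` is not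
  -- needed.
  have hpt : ∀ k, γ k ^ 2 * a k ^ 2
      ≤ δ * γ k + δ ^ (1 - q / 2) * (γ k ^ (1 + q / 2) * a k ^ q) := by
    intro k
    have hk := hγ k
    have hs0 : 0 ≤ γ k * a k ^ 2 := by positivity
    have hpow : (γ k * a k ^ 2) ^ (q / 2) = γ k ^ (q / 2) * a k ^ q := by
      rw [Real.mul_rpow hk.le (by positivity), ← Real.rpow_natCast, ← Real.rpow_mul (ha k)]
      congr 2; push_cast; ring
    have hγp : γ k ^ (1 + q / 2) = γ k * γ k ^ (q / 2) := by
      rw [Real.rpow_add hk, Real.rpow_one]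
    have key : γ k * a k ^ 2 ≤ δ + δ ^ (1 - q / 2) * (γ k * a k ^ 2) ^ (q / 2) := by
      rcases le_total (γ k * a k ^ 2) δ with hle | hle
      · have : 0 ≤ δ ^ (1 - q / 2) * (γ k * a k ^ 2) ^ (q / 2) := by positivity
        linarith
      · have hs : 0 < γ k * a k ^ 2 := hδ.trans_le hle
        have h1 : (γ k * a k ^ 2) ^ (1 - q / 2) ≤ δ ^ (1 - q / 2) :=
          Real.rpow_le_rpow_of_nonpos hδ hle (by linarith)
        have h2 : γ k * a k ^ 2 = (γ k * a k ^ 2) ^ (1 - q / 2) * (γ k * a k ^ 2) ^ (q / 2) := by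
          rw [← Real.rpow_add hs, sub_add_cancel, Real.rpow_one]
        have h3 := mul_le_mul_of_nonneg_right h1 (Real.rpow_nonneg hs0 (q / 2))
        linarith
    rw [hpow] at key
    have := mul_le_mul_of_nonneg_left key hk.le
    rw [hγp]
    linarith
  have hcs := (h.mul_left (δ ^ (1 - q / 2))).hasSum.tendsto_sum_nat.cauchySeq
  obtain ⟨n₀, hn₀⟩ := Metric.cauchySeq_iff.1 hcs (ε / 2) (half_pos hε)
  refine ⟨n₀, fun n hn m hm hT => ?_⟩
  rw [← Finset.sum_Ico_eq_sub _ hm, Real.norm_of_nonneg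
    (Finset.sum_nonneg fun k _ => by positivity)]
  refine (Finset.sum_le_sum fun k _ => hpt k).trans ?_
  rw [Finset.sum_add_distrib, ← Finset.mul_sum]
  have h1 := hn₀ m (hn.trans hm) n hn
  rw [Real.dist_eq, ← Finset.sum_Ico_eq_sub _ hm] at h1
  have h2 : δ * ∑ k ∈ Finset.Ico n m, γ k ≤ ε / 2 := by
    have h3 : δ * (1 + |T|) = ε / 2 := by rw [hδdef]; field_simp
    rw [← h3]
    exact mul_le_mul_of_nonneg_left (by linarith [le_abs_self T]) hδ.le
  linarith [(abs_lt.1 h1).2]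

end Averages

/-! ### Real martingale noise -/

section Noise

variable {Ω : Type*} {m0 : MeasurableSpace Ω} {P : Measure Ω}

/-- Weighted sums of real martingale differences with bounded moments of order `q` vanish on
windows when `∑ γ ^ (1 + q / 2) < ∞`. -/
theorem ae_vanishesOnWindows_of_martingale_difference [IsProbabilityMeasure P]
    {ℱ : Filtration ℕ m0} {γ : ℕ → ℝ} (hγ : ∀ n, 0 < γ n)
    (hdiv : Tendsto (fun n => ∑ i ∈ Finset.range n, γ i) atTop atTop)
    (hγ0 : Tendsto γ atTop (𝓝 0)) {q : ℝ} (hq : 2 ≤ q) {ζ : ℕ → Ω → ℝ}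
    (hζm : ∀ n, StronglyMeasurable[ℱ (n + 1)] (ζ n))
    (hζi : ∀ n, Integrable (ζ n) P) (hζq : ∀ n, Integrable (fun ω => |ζ n ω| ^ q) P)
    (hζ : ∀ n, P[ζ n | ℱ n] =ᵐ[P] 0)
    (hsum : Summable fun n => γ n ^ (1 + q / 2) * ∫ ω, |ζ n ω| ^ q ∂P) :
    ∀ᵐ ω ∂P, VanishesOnWindows γ fun n => ∑ k ∈ Finset.range n, γ k * ζ k ω := by
  have hq0 : 0 < q := by linarith
  obtain ⟨Γ, hΓ⟩ := hγ0.bddAbove_range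
  have hγΓ : ∀ n, γ n ≤ Γ := fun n => hΓ ⟨n, rfl⟩
  have hΓ0 : 0 ≤ Γ := (hγ 0).le.trans (hγΓ 0)
  obtain ⟨K, hK, hexp⟩ := abs_add_mul_rpow_le hq hΓ0
  let Z : ℕ → Ω → ℝ := fun n ω => weightedAverage γ (fun k => ζ k ω) n
  have hZad : StronglyAdapted ℱ Z := by
    intro n
    induction n with
    | zero => exact stronglyMeasurable_const
    | succ n ih =>
      have h1 : StronglyMeasurable[ℱ (n + 1)] (fun ω => (Z n ω + γ n * ζ n ω) * (1 + γ n)⁻¹) :=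
        ((ih.mono (ℱ.mono n.le_succ)).add ((hζm n).const_mul _)).mul_const _
      exact h1
  have hmeas : ∀ {X : Ω → ℝ} {m : MeasurableSpace Ω}, StronglyMeasurable[m] X →
      StronglyMeasurable[m] fun ω => |X ω| ^ q := fun hX =>
    ((Real.continuous_rpow_const hq0.le).comp continuous_abs).comp_stronglyMeasurable hX
  -- the moments of order `q`
  have hqadd : ∀ a b : ℝ, |a + b| ^ q ≤ 2 ^ q * (|a| ^ q + |b| ^ q) := by
    intro a b
    have h1 : |a + b| ≤ 2 * max |a| |b| := by
      linarith [abs_add_le a b, le_max_left |a| |b|, le_max_right |a| |b|]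
    refine (Real.rpow_le_rpow (abs_nonneg _) h1 hq0.le).trans ?_
    rw [Real.mul_rpow two_pos.le (by positivity)]
    refine mul_le_mul_of_nonneg_left ?_ (by positivity)
    have h2 : 0 ≤ |a| ^ q := by positivity
    have h3 : 0 ≤ |b| ^ q := by positivity
    rcases max_choice |a| |b| with h | h <;> rw [h] <;> linarith
  have hZq : ∀ n, Integrable (fun ω => |Z n ω| ^ q) P := by
    intro n
    induction n with
    | zero =>
      have : (fun ω => |Z 0 ω| ^ q) = fun _ => (0 : ℝ) := by
        funext ω
        simp [Z, weightedAverage, hq0.ne']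
      rw [this]
      exact integrable_zero _ _ _
    | succ n ih =>
      refine Integrable.mono' ((ih.add ((hζq n).const_mul (γ n ^ q))).const_mul (2 ^ q))
        ((hmeas (hZad (n + 1))).mono (ℱ.le _)).aestronglyMeasurable
        (Eventually.of_forall fun ω => ?_)
      rw [Real.norm_of_nonneg (by positivity)]
      have hp := hγ n
      have h1 : |Z (n + 1) ω| ≤ |Z n ω + γ n * ζ n ω| := by
        change |(Z n ω + γ n * ζ n ω) / (1 + γ n)| ≤ _
        rw [abs_div, abs_of_pos (show 0 < 1 + γ n by linarith)]
        exact div_le_self (abs_nonneg _) (by linarith)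
      refine (Real.rpow_le_rpow (abs_nonneg _) h1 hq0.le).trans ((hqadd _ _).trans_eq ?_)
      rw [abs_mul, abs_of_pos hp, Real.mul_rpow hp.le (abs_nonneg _)]
      rfl
  let κ : ℕ → ℝ := fun n => γ n * q / (1 + γ n)
  let d : ℕ → Ω → ℝ := fun n ω => (κ n * (|Z n ω| ^ (q - 2) * Z n ω)) * ζ n ω
  let r : ℕ → Ω → ℝ := fun n ω => K * (γ n ^ (1 + q / 2) * |ζ n ω| ^ q)
  have hφm : ∀ n, StronglyMeasurable[ℱ n] fun ω => κ n * (|Z n ω| ^ (q - 2) * Z n ω) := by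
    intro n
    have hc : Continuous fun z : ℝ => κ n * (|z| ^ (q - 2) * z) :=
      continuous_const.mul (((Real.continuous_rpow_const (by linarith)).comp continuous_abs).mul
        continuous_id)
    exact hc.comp_stronglyMeasurable (hZad n)
  have hdi : ∀ n, Integrable (d n) P := by
    intro n
    refine Integrable.mono' (((hZq n).add (hζq n)).const_mul |κ n|)
      ((((hφm n).mono (ℱ.le _)).mul ((hζm n).mono (ℱ.le _))).aestronglyMeasurable)
      (Eventually.of_forall fun ω => ?_)
    have h0 : ∀ z : ℝ, 0 ≤ z → z ^ q = z ^ (q - 2) * (z * z) := fun z hz => by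
      rw [← sq, ← Real.rpow_natCast, ← Real.rpow_add_of_nonneg hz (by linarith) (by norm_num)]
      congr 1; push_cast; ring
    have h1 : |Z n ω| ^ (q - 2) * (|Z n ω| * |ζ n ω|) ≤ |Z n ω| ^ q + |ζ n ω| ^ q := by
      have e1 : 0 ≤ |Z n ω| ^ q := by positivity
      have e2 : 0 ≤ |ζ n ω| ^ q := by positivity
      rcases le_total |ζ n ω| |Z n ω| with h | h
      · have : |Z n ω| ^ (q - 2) * (|Z n ω| * |ζ n ω|) ≤ |Z n ω| ^ q := by
          rw [h0 _ (abs_nonneg _)]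
          gcongr
        linarith
      · have : |Z n ω| ^ (q - 2) * (|Z n ω| * |ζ n ω|) ≤ |ζ n ω| ^ q := by
          rw [h0 _ (abs_nonneg (ζ n ω))]
          have := Real.rpow_le_rpow (abs_nonneg _) h (show 0 ≤ q - 2 by linarith)
          gcongr
        linarith
    have h2 : ‖d n ω‖ = |κ n| * (|Z n ω| ^ (q - 2) * (|Z n ω| * |ζ n ω|)) := by
      simp only [d, Real.norm_eq_abs, abs_mul]
      rw [abs_of_nonneg (Real.rpow_nonneg (abs_nonneg (Z n ω)) (q - 2))]
      ring
    rw [h2]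
    exact mul_le_mul_of_nonneg_left h1 (abs_nonneg _)
  have hd : ∀ n, P[d n | ℱ n] =ᵐ[P] 0 := by
    intro n
    have h1 := condExp_mul_of_stronglyMeasurable_left (hφm n) (hdi n) (hζi n)
    filter_upwards [h1, hζ n] with ω h1 h2
    refine Eq.trans h1 ?_
    rw [Pi.mul_apply, h2]
    simp
  have hstep : ∀ n ω, |Z (n + 1) ω| ^ q
      ≤ (1 - γ n * (2 * (1 + Γ))⁻¹) * |Z n ω| ^ q + d n ω + r n ω := by
    intro n ω
    have hp := hγ n
    have h1 := hexp (γ n) (Z n ω) (ζ n ω) hp (hγΓ n)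
    have hZ' : |Z (n + 1) ω| ^ q = |Z n ω + γ n * ζ n ω| ^ q / (1 + γ n) ^ q := by
      change |(Z n ω + γ n * ζ n ω) / (1 + γ n)| ^ q = _
      rw [abs_div, abs_of_pos (show 0 < 1 + γ n by linarith),
        Real.div_rpow (abs_nonneg _) (by linarith)]
    -- One factor `1 + γ n` of the denominator suffices: against the growth `1 + γ n / 2` it leaves
    -- a contraction rate comparable to `γ n`, whose sum diverges.
    have h2 : 1 + γ n ≤ (1 + γ n) ^ q := by
      conv_lhs => rw [← Real.rpow_one (1 + γ n)]
      exact Real.rpow_le_rpow_of_exponent_le (by linarith) (by linarith)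
    have h3 : |Z (n + 1) ω| ^ q ≤ |Z n ω + γ n * ζ n ω| ^ q / (1 + γ n) := by
      rw [hZ']
      exact div_le_div_of_nonneg_left (by positivity) (by linarith) h2
    refine h3.trans ((div_le_div_of_nonneg_right h1 (by linarith)).trans ?_)
    have h4 : (1 + γ n / 2) / (1 + γ n) ≤ 1 - γ n * (2 * (1 + Γ))⁻¹ := by
      have h5 : γ n * (2 * (1 + Γ))⁻¹ ≤ γ n * (2 * (1 + γ n))⁻¹ := by
        have := hγΓ n
        gcongr
      have h6 : (1 + γ n / 2) / (1 + γ n) = 1 - γ n * (2 * (1 + γ n))⁻¹ := by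
        field_simp; ring
      linarith
    have hU0 : 0 ≤ |Z n ω| ^ q := by positivity
    have hr0 : 0 ≤ K * (γ n ^ (1 + q / 2) * |ζ n ω| ^ q) := by positivity
    have h7 := mul_le_mul_of_nonneg_right h4 hU0
    have h8 := div_le_self hr0 (show 1 ≤ 1 + γ n by linarith)
    have h9 : ((1 + γ n / 2) * |Z n ω| ^ q + γ n * q * (|Z n ω| ^ (q - 2) * Z n ω) * ζ n ω
        + K * (γ n ^ (1 + q / 2) * |ζ n ω| ^ q)) / (1 + γ n)
        = (1 + γ n / 2) / (1 + γ n) * |Z n ω| ^ q + d n ω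
          + K * (γ n ^ (1 + q / 2) * |ζ n ω| ^ q) / (1 + γ n) := by
      simp only [d, κ]
      field_simp
    rw [h9]
    simp only [r]
    linarith
  have hlim := ae_tendsto_zero_of_le_contraction (ℱ := ℱ) (P := P) (U := fun n ω => |Z n ω| ^ q)
    (d := d) (r := r) (c := fun n => γ n * (2 * (1 + Γ))⁻¹) (fun n ω => by positivity)
    (fun n => hmeas (hZad n)) hZq hdi hd
    (fun n ω => mul_nonneg hK (mul_nonneg (Real.rpow_nonneg (hγ n).le _) (by positivity)))
    (fun n => ((hmeas (hζm n)).const_mul _).const_mul _)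
    (fun n => ((hζq n).const_mul _).const_mul _)
    (by
      simp only [r, integral_const_mul]
      exact hsum.mul_left K)
    (fun n => mul_nonneg (hγ n).le (by positivity))
    (by
      simp_rw [← Finset.sum_mul]
      exact hdiv.atTop_mul_const (by positivity)) hstep
  filter_upwards [hlim] with ω hω
  refine vanishesOnWindows_of_weightedAverage hγ ?_
  have h1 := hω.rpow_const (p := q⁻¹) (Or.inr (by positivity))
  rw [Real.zero_rpow (by positivity)] at h1
  rw [tendsto_zero_iff_abs_tendsto_zero]
  refine h1.congr fun n => ?_
  rw [← Real.rpow_mul (abs_nonneg _), mul_inv_cancel₀ hq0.ne', Real.rpow_one]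
  rfl

end Noise

/-! ### Vector noise and localization of the moments -/

section VectorNoise

variable {E : Type*} [NormedAddCommGroup E] [InnerProductSpace ℝ E]

theorem vanishesOnWindows_of_inner [FiniteDimensional ℝ E] {ι : Type*} [Fintype ι]
    (e : OrthonormalBasis ι ℝ E) {γ : ℕ → ℝ} {S : ℕ → E}
    (h : ∀ i, VanishesOnWindows γ fun n => inner ℝ (e i) (S n)) : VanishesOnWindows γ S := by
  intro T ε hε
  have hε' : 0 < ε / (Fintype.card ι + 1) := by positivity
  choose n₀ hn₀ using fun i => h i T _ hε'
  refine ⟨Finset.univ.sup n₀, fun n hn m hm hT => ?_⟩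
  have h1 : ∀ i, ‖inner ℝ (e i) (S m - S n)‖ ≤ ε / (Fintype.card ι + 1) := fun i => by
    rw [inner_sub_right]
    exact hn₀ i n ((Finset.le_sup (Finset.mem_univ i)).trans hn) m hm hT
  calc ‖S m - S n‖ = ‖∑ i, inner ℝ (e i) (S m - S n) • e i‖ := by rw [e.sum_repr']
    _ ≤ ∑ _i : ι, ε / (Fintype.card ι + 1) := by
        refine (norm_sum_le _ _).trans (Finset.sum_le_sum fun i _ => ?_)
        rw [norm_smul, e.norm_eq_one, mul_one]
        exact h1 i
    _ = Fintype.card ι * (ε / (Fintype.card ι + 1)) := by simp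
    _ ≤ (Fintype.card ι + 1) * (ε / (Fintype.card ι + 1)) := by gcongr; linarith
    _ = ε := by field_simp

variable {Ω : Type*} {m0 : MeasurableSpace Ω} {P : Measure Ω}

/-- Moment bounds in terms of the conditional Lebesgue expectation. -/
theorem integrable_indicator_rpow_of_condLExp_le {F Ω : Type*} [NormedAddCommGroup F]
    {m m0 : MeasurableSpace Ω}
    {P : Measure Ω} [IsProbabilityMeasure P] (hm : m ≤ m0) {ξ : Ω → F}
    (hξ : AEStronglyMeasurable ξ P) {q : ℝ} (hq : 0 < q) {A B : Set Ω}
    (hA : MeasurableSet[m] A) (hAB : A ⊆ B) {L : ℝ≥0}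
    (hL : ∀ ω ∈ A, condLExp m P (B.indicator fun ω' => ‖ξ ω'‖ₑ ^ q) ω ≤ L) :
    Integrable (A.indicator fun ω => ‖ξ ω‖ ^ q) P ∧
      ∫ ω, A.indicator (fun ω => ‖ξ ω‖ ^ q) ω ∂P ≤ L := by
  have hmeas : AEStronglyMeasurable (A.indicator fun ω => ‖ξ ω‖ ^ q) P :=
    ((Real.continuous_rpow_const hq.le).comp_aestronglyMeasurable hξ.norm).indicator (hm _ hA)
  have hle : ∫⁻ ω, ‖A.indicator (fun ω => ‖ξ ω‖ ^ q) ω‖ₑ ∂P ≤ L := by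
    calc ∫⁻ ω, ‖A.indicator (fun ω => ‖ξ ω‖ ^ q) ω‖ₑ ∂P
        = ∫⁻ ω, A.indicator (B.indicator fun ω' => ‖ξ ω'‖ₑ ^ q) ω ∂P := by
          refine lintegral_congr fun ω => ?_
          by_cases hω : ω ∈ A
          · rw [Set.indicator_of_mem hω, Set.indicator_of_mem hω, Set.indicator_of_mem (hAB hω),
              ← ofReal_norm, ← ofReal_norm, Real.norm_of_nonneg (by positivity),
              ENNReal.ofReal_rpow_of_nonneg (norm_nonneg _) hq.le]
          · simp [hω]
      _ = ∫⁻ ω in A, (B.indicator fun ω' => ‖ξ ω'‖ₑ ^ q) ω ∂P := lintegral_indicator (hm _ hA) _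
      _ = ∫⁻ ω in A, condLExp m P (B.indicator fun ω' => ‖ξ ω'‖ₑ ^ q) ω ∂P :=
          (setLIntegral_condLExp hm P _ hA).symm
      _ ≤ ∫⁻ _ in A, L ∂P := setLIntegral_mono measurable_const hL
      _ = L * P A := by simp
      _ ≤ L := by
          have : P A ≤ 1 := prob_le_one
          calc (L : ℝ≥0∞) * P A ≤ L * 1 := by gcongr
            _ = L := mul_one _
  have hint : Integrable (A.indicator fun ω => ‖ξ ω‖ ^ q) P :=
    ⟨hmeas, hle.trans_lt ENNReal.coe_lt_top⟩
  refine ⟨hint, ?_⟩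
  have h0 : ∀ ω, 0 ≤ A.indicator (fun ω => ‖ξ ω‖ ^ q) ω := fun ω =>
    Set.indicator_nonneg (fun _ _ => by positivity) ω
  rw [integral_eq_lintegral_of_nonneg_ae (Eventually.of_forall h0) hmeas]
  refine ENNReal.toReal_le_of_le_ofReal L.2 ?_
  refine le_trans (le_of_eq ?_) (hle.trans_eq (ENNReal.ofReal_coe_nnreal (p := L)).symm)
  exact lintegral_congr fun ω => by rw [← ofReal_norm, Real.norm_of_nonneg (h0 ω)]

/-- Weighted sums of martingale transforms by bounded predictable vectors vanish on windows. -/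
theorem ae_vanishesOnWindows_inner [FiniteDimensional ℝ E] [IsProbabilityMeasure P]
    {ℱ : Filtration ℕ m0}
    {γ : ℕ → ℝ} (hγ : ∀ n, 0 < γ n)
    (hdiv : Tendsto (fun n => ∑ i ∈ Finset.range n, γ i) atTop atTop)
    (hγ0 : Tendsto γ atTop (𝓝 0)) {q : ℝ} (hq : 2 ≤ q)
    (hγs : Summable fun n => γ n ^ (1 + q / 2)) {η : ℕ → Ω → E}
    (hη : IsMartingaleDifference ℱ P η) {A : ℕ → Set Ω} {L : ℝ}
    (hAi : ∀ n, Integrable ((A n).indicator fun ω => ‖η (n + 1) ω‖ ^ q) P)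
    (hAL : ∀ n, ∫ ω, (A n).indicator (fun ω => ‖η (n + 1) ω‖ ^ q) ω ∂P ≤ L)
    {h : ℕ → Ω → E} (hh : ∀ n, StronglyMeasurable[ℱ n] (h n)) {R : ℝ} (hR : ∀ n ω, ‖h n ω‖ ≤ R)
    (hA : ∀ n, ∀ ω ∉ A n, h n ω = 0) :
    ∀ᵐ ω ∂P, VanishesOnWindows γ
      fun n => ∑ k ∈ Finset.range n, γ k * inner ℝ (h k ω) (η (k + 1) ω) := by
  obtain ⟨hηad, hηi, hηc⟩ := hη
  have hq0 : 0 < q := by linarith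
  have hζm : ∀ n, StronglyMeasurable[ℱ (n + 1)] fun ω => inner ℝ (h n ω) (η (n + 1) ω) := fun n =>
    ((hh n).mono (ℱ.mono n.le_succ)).inner (hηad (n + 1))
  have hζi : ∀ n, Integrable (fun ω => inner ℝ (h n ω) (η (n + 1) ω)) P := by
    intro n
    refine Integrable.mono' ((hηi (n + 1)).norm.const_mul R)
      ((hζm n).mono (ℱ.le _)).aestronglyMeasurable (Eventually.of_forall fun ω => ?_)
    exact (norm_inner_le_norm _ _).trans (mul_le_mul_of_nonneg_right (hR n ω) (norm_nonneg _))
  have hζle : ∀ n ω, |inner ℝ (h n ω) (η (n + 1) ω)| ^ q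
      ≤ R ^ q * (A n).indicator (fun ω => ‖η (n + 1) ω‖ ^ q) ω := by
    intro n ω
    have hR0 : 0 ≤ R := (norm_nonneg _).trans (hR n ω)
    by_cases hω : ω ∈ A n
    · rw [Set.indicator_of_mem hω, ← Real.mul_rpow hR0 (norm_nonneg _)]
      refine Real.rpow_le_rpow (abs_nonneg _) ?_ hq0.le
      exact (abs_real_inner_le_norm _ _).trans
        (mul_le_mul_of_nonneg_right (hR n ω) (norm_nonneg _))
    · simp [hA n ω hω, hω, hq0.ne']
  have hζq : ∀ n, Integrable (fun ω => |inner ℝ (h n ω) (η (n + 1) ω)| ^ q) P := by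
    intro n
    refine Integrable.mono' ((hAi n).const_mul (R ^ q))
      ((((Real.continuous_rpow_const hq0.le).comp continuous_abs).comp_stronglyMeasurable
        (hζm n)).mono (ℱ.le _)).aestronglyMeasurable (Eventually.of_forall fun ω => ?_)
    rw [Real.norm_of_nonneg (by positivity)]
    exact hζle n ω
  refine ae_vanishesOnWindows_of_martingale_difference hγ hdiv hγ0 hq hζm hζi hζq (fun n => ?_) ?_
  · have h1 := condExp_bilin_of_stronglyMeasurable_left (innerSL ℝ) (hh n) (hζi n) (hηi (n + 1))
    filter_upwards [h1, hηc n] with ω h1 h2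
    refine Eq.trans h1 ?_
    rw [h2]
    simp
  · refine Summable.of_nonneg_of_le
      (fun n => mul_nonneg (Real.rpow_nonneg (hγ n).le _) (integral_nonneg fun ω => by positivity))
      (fun n => ?_) (hγs.mul_right (|R ^ q| * |L|))
    refine mul_le_mul_of_nonneg_left ?_ (Real.rpow_nonneg (hγ n).le _)
    refine (integral_mono (hζq n) ((hAi n).const_mul _) (hζle n)).trans ?_
    rw [integral_const_mul]
    have h0 : 0 ≤ ∫ ω, (A n).indicator (fun ω => ‖η (n + 1) ω‖ ^ q) ω ∂P :=
      integral_nonneg fun ω => Set.indicator_nonneg (fun _ _ => by positivity) ω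
    exact mul_le_mul (le_abs_self _) ((hAL n).trans (le_abs_self L)) h0 (abs_nonneg _)

/-- All noise terms of the energy estimate vanish on windows along the trajectories for which the
iterates and the conditional moments of the noise stay below given levels. -/
theorem ae_vanishesOnWindows_noise [FiniteDimensional ℝ E] [IsProbabilityMeasure P]
    {ℱ : Filtration ℕ m0}
    {γ : ℕ → ℝ} (hγ : ∀ n, 0 < γ n)
    (hdiv : Tendsto (fun n => ∑ i ∈ Finset.range n, γ i) atTop atTop)
    (hγ0 : Tendsto γ atTop (𝓝 0)) {q : ℝ} (hq : 2 ≤ q)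
    (hγs : Summable fun n => γ n ^ (1 + q / 2)) {η x : ℕ → Ω → E}
    (hη : IsMartingaleDifference ℱ P η) (hx : StronglyAdapted ℱ x) (R L : ℝ≥0) :
    ∀ᵐ ω ∂P, (∀ n, ‖x n ω‖ ≤ R) →
      (∀ n, condLExp (ℱ n) P ({ω' | x n ω' ∈ Metric.closedBall 0 (R : ℝ)}.indicator
        fun ω' => ‖η (n + 1) ω'‖ₑ ^ q) ω ≤ L) →
      VanishesOnWindows γ (fun n => ∑ k ∈ Finset.range n, γ k • η (k + 1) ω) ∧
      VanishesOnWindows γ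
        (fun n => ∑ k ∈ Finset.range n, γ k * inner ℝ (η (k + 1) ω) (x k ω)) ∧
      VanishesOnWindows γ (fun n => ∑ k ∈ Finset.range n, γ k ^ 2 * ‖η (k + 1) ω‖ ^ 2) := by
  have hq0 : 0 < q := by linarith
  -- Each `A n` is `ℱ n`-measurable, so cutting off the integrands by its indicator preserves the
  -- martingale property and gives deterministic moment bounds. Trajectories satisfying the two
  -- hypotheses lie in every `A n`, where nothing was cut.
  let A : ℕ → Set Ω := fun n => {ω | x n ω ∈ Metric.closedBall 0 (R : ℝ)} ∩
    {ω | condLExp (ℱ n) P ({ω' | x n ω' ∈ Metric.closedBall 0 (R : ℝ)}.indicator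
        fun ω' => ‖η (n + 1) ω'‖ₑ ^ q) ω ≤ L}
  have hAm : ∀ n, MeasurableSet[ℱ n] (A n) := by
    intro n
    refine MeasurableSet.inter ?_ (measurableSet_le (measurable_condLExp _ _ _) measurable_const)
    simp only [mem_closedBall_zero_iff]
    exact (hx n).norm.measurable measurableSet_Iic
  have hmom := fun n => integrable_indicator_rpow_of_condLExp_le (P := P) (ℱ.le n)
    (hη.2.1 (n + 1)).aestronglyMeasurable hq0 (hAm n) Set.inter_subset_left (L := L)
    (fun ω hω => hω.2)
  -- The predictable integrands are the basis vectors for the sums of `γ η`, and the iterate itself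
  -- for the sums of `γ ⟪η, x⟫`.
  have hM := fun i => ae_vanishesOnWindows_inner hγ hdiv hγ0 hq hγs hη (fun n => (hmom n).1)
    (fun n => (hmom n).2) (h := fun n => (A n).indicator fun _ => stdOrthonormalBasis ℝ E i)
    (fun n => stronglyMeasurable_const.indicator (hAm n)) (R := 1)
    (fun n ω => (norm_indicator_le_norm_self _ _).trans (by simp))
    (fun n ω hω => Set.indicator_of_notMem hω _)
  have hN := ae_vanishesOnWindows_inner hγ hdiv hγ0 hq hγs hη (fun n => (hmom n).1)
    (fun n => (hmom n).2) (h := fun n => (A n).indicator (x n))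
    (fun n => (hx n).indicator (hAm n)) (R := R)
    (fun n ω => by
      by_cases hω : ω ∈ A n
      · rw [Set.indicator_of_mem hω]
        simpa using hω.1
      · simp [hω])
    (fun n ω hω => Set.indicator_of_notMem hω _)
  have hQ := ae_summable_of_summable_integral (P := P)
    (r := fun n ω => γ n ^ (1 + q / 2) * (A n).indicator (fun ω => ‖η (n + 1) ω‖ ^ q) ω)
    (fun n ω => mul_nonneg (Real.rpow_nonneg (hγ n).le _)
      (Set.indicator_nonneg (fun _ _ => by positivity) ω))
    (fun n => (hmom n).1.const_mul _)
    (by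
      simp_rw [integral_const_mul]
      refine Summable.of_nonneg_of_le (fun n => mul_nonneg (Real.rpow_nonneg (hγ n).le _)
        (integral_nonneg fun ω => Set.indicator_nonneg (fun _ _ => by positivity) ω))
        (fun n => mul_le_mul_of_nonneg_left (hmom n).2 (Real.rpow_nonneg (hγ n).le _))
        (hγs.mul_right (L : ℝ)))
  filter_upwards [ae_all_iff.2 hM, hN, hQ] with ω hM hN hQ hxR hL
  have hωA : ∀ n, ω ∈ A n := fun n => ⟨by simpa using hxR n, hL n⟩
  refine ⟨vanishesOnWindows_of_inner (stdOrthonormalBasis ℝ E) fun i => ?_, ?_,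
    vanishesOnWindows_sum_sq hγ (fun n => norm_nonneg _) hq ?_⟩
  · have := hM i
    simp only [Set.indicator_of_mem (hωA _)] at this
    simpa only [inner_sum, real_inner_smul_right] using this
  · simp only [Set.indicator_of_mem (hωA _)] at hN
    simpa only [real_inner_comm] using hN
  · simpa only [Set.indicator_of_mem (hωA _)] using hQ

end VectorNoise

end SPGD

/-! ### Assembly: applying the deterministic half along almost every trajectory -/

theorem proposition3p1 {d : ℕ}
    -- the closed convex set and the two locally Lipschitz functions
    (C : Set (EuclideanSpace ℝ (Fin d))) (hC_closed : IsClosed C) (hC_convex : Convex ℝ C)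
    (f g : EuclideanSpace ℝ (Fin d) → ℝ) (hf : LocallyLipschitz f) (hg : LocallyLipschitz g)
    -- the probability space, the filtration, the noise and the iterates
    {Ω : Type*} {m0 : MeasurableSpace Ω} (P : Measure Ω) [IsProbabilityMeasure P]
    (ℱ : Filtration ℕ m0)
    (η x v : ℕ → Ω → EuclideanSpace ℝ (Fin d))
    (hη : SPGD.IsMartingaleDifference ℱ P η)
    (hx : StronglyAdapted ℱ x)
    -- the step sizes
    (γ : ℕ → ℝ) (hγ : ∀ n, 0 < γ n)
    (hγ_div : Tendsto (fun n => ∑ i ∈ Finset.range n, γ i) atTop atTop)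
    -- the stochastic proximal subgradient descent
    (hv : ∀ n, ∀ᵐ ω ∂P, v n ω ∈ SPGD.clarkeSubdifferential f (x n ω))
    (hstep : ∀ n, ∀ᵐ ω ∂P,
      x (n + 1) ω ∈ SPGD.prox g C (γ n) (x n ω - γ n • v n ω + γ n • η (n + 1) ω))
    -- boundedness of the iterates and the moment condition on the noise
    (hbdd : ∀ᵐ ω ∂P, BddAbove (Set.range fun n => ‖x n ω‖))
    (q : ℝ) (hq : 2 ≤ q) (hγ_sum : Summable fun n => γ n ^ (1 + q / 2))
    (hnoise : ∀ K : Set (EuclideanSpace ℝ (Fin d)), IsCompact K → ∀ᵐ ω ∂P,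
      (⨆ n, condLExp (ℱ n) P
        ({ω' | x n ω' ∈ K}.indicator fun ω' => ‖η (n + 1) ω'‖ₑ ^ q) ω) < ∞) :
    ∀ᵐ ω ∂P,
      IsCompact (closure (Set.range
        (SPGD.shift (SPGD.interpolatedProcess γ hγ hγ_div fun n => x n ω)))) ∧
      ∀ (t : ℕ → ℝ≥0) (y : C(ℝ≥0, EuclideanSpace ℝ (Fin d))),
        Tendsto t atTop atTop →
        Tendsto (fun n => SPGD.shift (SPGD.interpolatedProcess γ hγ hγ_div fun k => x k ω) (t n))
          atTop (𝓝 y) →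
        SPGD.IsSolution (SPGD.drift f g C) y := by
  have hq2 : 1 + q / 2 ≠ 0 := by linarith
  have hγ0 : Tendsto γ atTop (𝓝 0) := by
    have h1 := hγ_sum.tendsto_atTop_zero.rpow_const (p := (1 + q / 2)⁻¹)
      (Or.inr (inv_nonneg.2 (by linarith)))
    rw [Real.zero_rpow (inv_ne_zero hq2)] at h1
    refine h1.congr fun n => ?_
    rw [← Real.rpow_mul (hγ n).le, mul_inv_cancel₀ hq2, Real.rpow_one]
  -- The bounds on iterates and moments depend on `ω`; integer levels `a`, `b` keep the number of
  -- null sets countable.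
  have hmom : ∀ᵐ ω ∂P, ∀ a : ℕ, (⨆ n, condLExp (ℱ n) P
      ({ω' | x n ω' ∈ Metric.closedBall 0 (((a : ℝ≥0) : ℝ))}.indicator
        fun ω' => ‖η (n + 1) ω'‖ₑ ^ q) ω) < ∞ :=
    ae_all_iff.2 fun a => hnoise _ (isCompact_closedBall _ _)
  have hvan : ∀ᵐ ω ∂P, ∀ a b : ℕ, _ := ae_all_iff.2 fun a : ℕ => ae_all_iff.2 fun b : ℕ =>
    SPGD.ae_vanishesOnWindows_noise (P := P) hγ hγ_div hγ0 hq hγ_sum hη hx (a : ℝ≥0) (b : ℝ≥0)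
  filter_upwards [ae_all_iff.2 hv, ae_all_iff.2 hstep, hbdd, hmom, hvan]
    with ω hv hstep hbdd hmom hvan
  obtain ⟨R, hR⟩ := hbdd
  obtain ⟨a, ha⟩ := exists_nat_ge R
  have hxa : ∀ n, ‖x n ω‖ ≤ ((a : ℝ≥0) : ℝ) := fun n => by
    simpa using (hR ⟨n, rfl⟩).trans ha
  obtain ⟨b, hb⟩ := ENNReal.exists_nat_gt (hmom a).ne
  obtain ⟨hM, hN, hQ⟩ := hvan a b hxa fun n => by
    simpa using (le_iSup (fun n => condLExp (ℱ n) P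
      ({ω' | x n ω' ∈ Metric.closedBall 0 (((a : ℝ≥0) : ℝ))}.indicator
        fun ω' => ‖η (n + 1) ω'‖ₑ ^ q) ω) n).trans hb.le
  -- The proximal step is implicit, so `w n` is a subgradient of `g` at `x (n + 1)`, whereas `v n`
  -- is one of `f` at `x n`.
  choose w hw hvar using fun n =>
    SPGD.exists_clarkeSubgradient_of_mem_prox hg hC_convex (hγ n) (hstep n)
  have hball := isCompact_closedBall (0 : EuclideanSpace ℝ (Fin d)) ((a : ℝ≥0) : ℝ)
  obtain ⟨Lf, -, hLf⟩ := hf.exists_clarkeSubdifferential_bound hball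
  obtain ⟨Lg, -, hLg⟩ := hg.exists_clarkeSubdifferential_bound hball
  have hmem : ∀ n, x n ω ∈ Metric.closedBall (0 : EuclideanSpace ℝ (Fin d)) ((a : ℝ≥0) : ℝ) :=
    fun n => by simpa using hxa n
  have hpath : SPGD.IsApproximatePath C γ (fun n => x n ω) (fun n => v n ω + w n)
      (fun n => ∑ k ∈ Finset.range n, γ k • η (k + 1) ω)
      (fun n => ∑ k ∈ Finset.range n, γ k * inner ℝ (η (k + 1) ω) (x k ω))
      (fun n => ∑ k ∈ Finset.range n, γ k ^ 2 * ‖η (k + 1) ω‖ ^ 2) ((a : ℝ≥0) : ℝ) (Lf + Lg) :=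
    { pos := hγ
      mem := fun n => (hstep n).1
      norm_le := hxa
      norm_drift_le := fun n => (norm_add_le _ _).trans
        (add_le_add (hLf _ (hmem n) _ (hv n)) (hLg _ (hmem (n + 1)) _ (hw n)))
      energy := fun n z hz => by
        have h1 : inner ℝ (x (n + 1) ω - x n ω + γ n • (v n ω + w n) - γ n • η (n + 1) ω)
            (x (n + 1) ω - z) ≤ 0 := by
          refine le_of_eq_of_le ?_ (hvar n z hz)
          congr 1
          module
        have h2 := SPGD.half_norm_sub_sq_le_of_inner_nonpos h1
        simp only [Finset.sum_range_succ, add_sub_cancel_left]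
        exact h2
      vanishes_M := hM
      vanishes_N := hN
      vanishes_Q := hQ }
  exact ⟨hpath.isCompact_closure_range_shift hγ hγ_div hγ0, fun t y ht hy =>
    hpath.isSolution_of_tendsto hγ hγ_div hγ0 hf hg hv hw ht hy⟩
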